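/- Let $\Omega\subseteq\mathbb R^n$ be open and let $\mathcal G(\Omega)$ be the (special) Colombeau algebra: families $(u_\varepsilon)_{\varepsilon\in(0,1]}$ in $C^\infty(\Omega)$ that are moderate (for every compact $K\subset\Omega$ and every $\alpha\in\mathbb N_0^n$ there is $N\in\mathbb N_0$ with $\sup_K|\partial^\alpha u_\varepsilon|=O(\varepsilon^{-N})$ as $\varepsilon\to0$), modulo negligible ones (for all $K$, $\alpha$ and all $q\in\mathbb N_0$, $\sup_K|\partial^\alpha u_\varepsilon|=O(\varepsilon^{q})$). *Wave front set.* A family $(g_\varepsilon)$ of functions on $\mathbb R^n$ is rapidly decreasing in $\Gamma\subseteq\mathbb R^n$ if there is $M\in\mathbb N_0$ such that for all $l\in\mathbb N_0$ there are $C>0$ and $0<\varepsilon_0<1$ with $|g_\varepsilon(\xi)|\le C\varepsilon^{-M}(1+|\xi|)^{-l}$ for all $\xi\in\Gamma$, $0<\varepsilon<\varepsilon_0$. For $u=[(u_\varepsilon)_\varepsilon]\in\mathcal G(\Omega)$, the set $\mathrm{WF}_g(u)\subseteq\Omega\times(\mathbb R^n\setminus\{0\})$ is defined as follows: $(x_0,\xi_0)\notin\mathrm{WF}_g(u)$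 if and only if there are $\varphi\in\mathcal D(\Omega)$ with $\varphi(x_0)\ne0$ and an open conic neighbourhood $\Gamma$ of $\xi_0$ such that the family $\xi\mapsto\int\varphi(x)u_\varepsilon(x)e^{-i\xi x}\,dx$ is rapidly decreasing in $\Gamma$ (this does not depend on the representative). *Operator.* Let $P_\varepsilon(x,D)=\sum_{|\alpha|\le m}a_\alpha^\varepsilon(x)D^\alpha$, $D=-i\partial$, be a family of differential operators of order $m$ whose coefficients $(a_\alpha^\varepsilon)_\varepsilon$ are moderate families on $\Omega$ (representatives of elements $a_\alpha$ of $\mathcal G(\Omega)$). Let $P=\sum_{|\alpha|\le m}a_\alpha D^\alpha$ be the corresponding operator on $\mathcal G(\Omega)$, so that $P[(u_\varepsilon)_\varepsilon]=[(P_\varepsilon u_\varepsilon)_\varepsilon]$, and let $P_\varepsilon(x,\xi)=\sum_{|\alpha|\le m}a_\alpha^\varepsilon(x)\xi^\alpha$ be its symbol. *Microlocal hypoellipticity.* A net $(r_\varepsilon)_{\varepsilon\in(0,1]}$ of positive numbers is of slow scale if for every $p\in\mathbb N_0$ there is $\varepsilon_p>0$ with $r_\varepsilon^p\le\varepsilon^{-1}$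 for $0<\varepsilon<\varepsilon_p$. Let $\Lambda\subseteq\Omega\times(\mathbb R^n\setminus\{0\})$ be open and conic in the second variable, with projection $U$ to $\Omega$. We say that $P$ satisfies the hypoellipticity conditions on $\Lambda$ if there are $m_0\in\mathbb R$ and $0\le\delta<\rho\le1$ such that for every compact $K\subset U$: 1. there are $q>0$, a net $(r_\varepsilon)$ of slow scale and $\varepsilon_0>0$ such that $|P_\varepsilon(x,\xi)|\ge\varepsilon^q(1+|\xi|)^{m_0}$ for all $(x,\xi)\in\Lambda$ with $x\in K$, $|\xi|\ge r_\varepsilon$, and $0<\varepsilon<\varepsilon_0$; 2. for every $\alpha\in\mathbb N_0^n$ there are nets $(s^\alpha_\varepsilon)$, $(r^\alpha_\varepsilon)$ of slow scale and $\varepsilon_\alpha>0$ such that for all $\beta\in\mathbb N_0^n$ with $0\le|\beta|\le m$ $$|\partial_x^\alpha\partial_\xi^\beta P_\varepsilon(x,\xi)|\le s^\alpha_\varepsilon\,|P_\varepsilon(x,\xi)|\,(1+|\xi|)^{\delta|\alpha|-\rho|\beta|}$$ for all $(x,\xi)\in\Lambda$ with $x\in K$, $|\xi|\ge r^\alpha_\varepsilon$,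 and $0<\varepsilon<\varepsilon_\alpha$. Let $M_g(P)$ be the union of all open conic sets $\Lambda\subseteq\Omega\times(\mathbb R^n\setminus\{0\})$ on which $P$ satisfies the hypoellipticity conditions, and let $M_g(P)^c$ be its complement in $\Omega\times(\mathbb R^n\setminus\{0\})$. Then for every $u\in\mathcal G(\Omega)$ $$\mathrm{WF}_g(u)\subseteq\mathrm{WF}_g(Pu)\cup M_g(P)^c .$$ -/

import Mathlib

open scoped ContDiff Distributions

noncomputable section

namespace Colombeau

/-- The parameter interval `(0, 1]` of the regularisation parameter `ε`. -/
abbrev Param : Type := Set.Ioc (0 : ℝ) 1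

/-- Euclidean space `ℝⁿ`. -/
abbrev Eucl (n : ℕ) : Type := EuclideanSpace ℝ (Fin n)

variable {n : ℕ}

/-! ### Multi-indices and derivatives -/

/-- The length `|α| = α₁ + ⋯ + αₙ` of a multi-index. -/
def len (α : Fin n → ℕ) : ℕ := ∑ i, α i

/-- The finite set of multi-indices `α` with `|α| ≤ m`. -/
def multiIndices (n m : ℕ) : Finset (Fin n → ℕ) :=
  (Fintype.piFinset fun _ => Finset.range (m + 1)).filter fun α => len α ≤ m

theorem mem_multiIndices {m : ℕ} {α : Fin n → ℕ} : α ∈ multiIndices n m ↔ len α ≤ m := by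
  simp only [multiIndices, Finset.mem_filter, Fintype.mem_piFinset, Finset.mem_range,
    and_iff_right_iff_imp]
  intro h i
  have : α i ≤ ∑ j, α j := Finset.single_le_sum (fun _ _ => Nat.zero_le _) (Finset.mem_univ i)
  unfold len at h
  omega

/-- For operators `d₁, …, dₙ`, the power `d^α = d₁^α₁ ∘ ⋯ ∘ dₙ^αₙ`. -/
def multiPow {X : Type*} (d : Fin n → X → X) (α : Fin n → ℕ) (u : X) : X :=
  (List.finRange n).foldr (fun i v => (d i)^[α i] v) u

/-- The partial derivative `∂ᵢ f`. -/
def partialDeriv (i : Fin n) (f : Eucl n → ℂ) : Eucl n → ℂ :=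
  fun x => fderiv ℝ f x (EuclideanSpace.single i 1)

/-- The higher partial derivative `∂^α f`. -/
def multiDeriv (α : Fin n → ℕ) (f : Eucl n → ℂ) : Eucl n → ℂ :=
  multiPow partialDeriv α f

/-! ### The Colombeau algebra -/

/-- All partial derivatives of order `k` of `u_ε` are `O(ε^p)` as `ε → 0`, uniformly on `K`. -/
def DerivBound (K : Set (Eucl n)) (k : ℕ) (p : ℤ) (u : Param → Eucl n → ℂ) : Prop :=
  ∃ C : ℝ, ∃ ε₀ : ℝ, 0 < ε₀ ∧ ∀ ε : Param, (ε : ℝ) < ε₀ → ∀ x ∈ K,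
    ‖iteratedFDeriv ℝ k (u ε) x‖ ≤ C * (ε : ℝ) ^ p

theorem DerivBound.mono {K : Set (Eucl n)} {k : ℕ} {p q : ℤ} {u : Param → Eucl n → ℂ}
    (h : DerivBound K k p u) (hq : q ≤ p) : DerivBound K k q u := by
  obtain ⟨C, ε₀, hε₀, h⟩ := h
  refine ⟨|C|, ε₀, hε₀, fun ε hε x hx => (h ε hε x hx).trans ?_⟩
  have h1 : (ε : ℝ) ^ p ≤ (ε : ℝ) ^ q := zpow_le_zpow_right_of_le_one₀ ε.2.1 ε.2.2 hq
  have h2 : (0 : ℝ) ≤ (ε : ℝ) ^ p := zpow_nonneg ε.2.1.le p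
  calc C * (ε : ℝ) ^ p ≤ |C| * (ε : ℝ) ^ p := mul_le_mul_of_nonneg_right (le_abs_self C) h2
    _ ≤ |C| * (ε : ℝ) ^ q := mul_le_mul_of_nonneg_left h1 (abs_nonneg C)

theorem DerivBound.add {Ω : TopologicalSpace.Opens (Eucl n)} {K : Set (Eucl n)} {k : ℕ} {p : ℤ}
    {u v : Param → Eucl n → ℂ} (hK : K ⊆ Ω)
    (hu : ∀ ε, ContDiffOn ℝ ∞ (u ε) Ω) (hv : ∀ ε, ContDiffOn ℝ ∞ (v ε) Ω)
    (h : DerivBound K k p u) (h' : DerivBound K k p v) : DerivBound K k p (u + v) := by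
  obtain ⟨C, e, he, h⟩ := h
  obtain ⟨C', e', he', h'⟩ := h'
  refine ⟨C + C', min e e', lt_min he he', fun ε hε x hx => ?_⟩
  have hx' := Ω.isOpen.mem_nhds (hK hx)
  have e1 : iteratedFDeriv ℝ k (u ε + v ε) x
      = iteratedFDeriv ℝ k (u ε) x + iteratedFDeriv ℝ k (v ε) x :=
    iteratedFDeriv_add_apply
      (((hu ε).contDiffAt hx').of_le (by exact_mod_cast le_top))
      (((hv ε).contDiffAt hx').of_le (by exact_mod_cast le_top))
  have e2 : (u + v) ε = u ε + v ε := rfl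
  rw [e2, e1, add_mul]
  exact (norm_add_le _ _).trans (add_le_add (h ε (hε.trans_le (min_le_left _ _)) x hx)
    (h' ε (hε.trans_le (min_le_right _ _)) x hx))

theorem DerivBound.mul {Ω : TopologicalSpace.Opens (Eucl n)} {K : Set (Eucl n)} {k : ℕ} {p q : ℤ}
    {u v : Param → Eucl n → ℂ} (hK : K ⊆ Ω)
    (hu : ∀ ε, ContDiffOn ℝ ∞ (u ε) Ω) (hv : ∀ ε, ContDiffOn ℝ ∞ (v ε) Ω)
    (h : ∀ j ≤ k, DerivBound K j p u) (h' : ∀ j ≤ k, DerivBound K j q v) :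
    DerivBound K k (p + q) (u * v) := by
  have h1 : ∀ j : Fin (k + 1), DerivBound K j p u := fun j => h j (by omega)
  have h1' : ∀ j : Fin (k + 1), DerivBound K j q v := fun j => h' j (by omega)
  choose C e he h1 using h1
  choose C' e' he' h1' using h1'
  have hmin : ∃ ε₀ : ℝ, 0 < ε₀ ∧ ∀ j, ε₀ ≤ e j ∧ ε₀ ≤ e' j := by
    refine ⟨Finset.univ.inf' Finset.univ_nonempty (fun j => min (e j) (e' j)), ?_, fun j => ?_⟩
    · rw [Finset.lt_inf'_iff]
      exact fun j _ => lt_min (he j) (he' j)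
    · have := Finset.inf'_le (fun j => min (e j) (e' j)) (Finset.mem_univ j)
      exact ⟨this.trans (min_le_left _ _), this.trans (min_le_right _ _)⟩
  obtain ⟨ε₀, hε₀, hle⟩ := hmin
  refine ⟨∑ j : Fin (k + 1), (k.choose j : ℝ) * C j * C' (Fin.rev j), ε₀, hε₀,
    fun ε hε x hx => ?_⟩
  have hxΩ := hK hx
  have key := norm_iteratedFDerivWithin_mul_le (hu ε) (hv ε) Ω.isOpen.uniqueDiffOn hxΩ
    (n := k) (by exact_mod_cast le_top)
  simp only [iteratedFDerivWithin_of_isOpen _ Ω.isOpen hxΩ] at key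
  have e2 : (u * v) ε = fun y => u ε y * v ε y := rfl
  rw [e2]
  refine key.trans ?_
  rw [Finset.sum_range, Finset.sum_mul]
  refine Finset.sum_le_sum fun j _ => ?_
  have b1 := h1 j ε (hε.trans_le (hle j).1) x hx
  have b2 := h1' (Fin.rev j) ε (hε.trans_le (hle _).2) x hx
  have hr : ((Fin.rev j : Fin (k + 1)) : ℕ) = k - j := by simp [Fin.val_rev]
  rw [hr] at b2
  have hε' : (ε : ℝ) ≠ 0 := ε.2.1.ne'
  calc (k.choose j : ℝ) * ‖iteratedFDeriv ℝ j (u ε) x‖ * ‖iteratedFDeriv ℝ (k - j) (v ε) x‖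
      = (k.choose j : ℝ) * (‖iteratedFDeriv ℝ j (u ε) x‖ * ‖iteratedFDeriv ℝ (k - j) (v ε) x‖) := by
        ring
    _ ≤ (k.choose j : ℝ) * ((C j * (ε : ℝ) ^ p) * (C' (Fin.rev j) * (ε : ℝ) ^ q)) := by
        refine mul_le_mul_of_nonneg_left ?_ (Nat.cast_nonneg _)
        exact mul_le_mul b1 b2 (norm_nonneg _) ((norm_nonneg _).trans b1)
    _ = (k.choose j : ℝ) * C j * C' (Fin.rev j) * (ε : ℝ) ^ (p + q) := by
        rw [zpow_add₀ hε']; ring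

/-- `(u_ε)_ε` is a moderate net of smooth functions on `Ω`. The values of `u_ε` outside of `Ω`
are irrelevant. -/
def IsModerate (Ω : TopologicalSpace.Opens (Eucl n)) (u : Param → Eucl n → ℂ) : Prop :=
  (∀ ε, ContDiffOn ℝ ∞ (u ε) Ω) ∧
    ∀ K : Set (Eucl n), IsCompact K → K ⊆ Ω → ∀ k : ℕ, ∃ N : ℕ, DerivBound K k (-(N : ℤ)) u

/-- The negligibility estimates on `Ω`. -/
def IsNegligible (Ω : TopologicalSpace.Opens (Eucl n)) (u : Param → Eucl n → ℂ) : Prop :=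
  ∀ K : Set (Eucl n), IsCompact K → K ⊆ Ω → ∀ k : ℕ, ∀ q : ℕ, DerivBound K k (q : ℤ) u

theorem IsModerate.uniform {Ω : TopologicalSpace.Opens (Eucl n)} {u : Param → Eucl n → ℂ}
    (h : IsModerate Ω u) {K : Set (Eucl n)} (hK : IsCompact K) (hKΩ : K ⊆ Ω) (k : ℕ) :
    ∃ N : ℕ, ∀ j ≤ k, DerivBound K j (-(N : ℤ)) u := by
  choose N hN using h.2 K hK hKΩ
  refine ⟨∑ j ∈ Finset.range (k + 1), N j, fun j hj => (hN j).mono ?_⟩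
  have : N j ≤ ∑ i ∈ Finset.range (k + 1), N i :=
    Finset.single_le_sum (fun _ _ => Nat.zero_le _) (Finset.mem_range.2 (by omega))
  omega

theorem isModerate_const (Ω : TopologicalSpace.Opens (Eucl n)) (c : ℂ) :
    IsModerate Ω (fun _ _ => c) := by
  refine ⟨fun ε => contDiffOn_const, fun K _ _ k => ⟨0, ‖c‖, 1, one_pos, fun ε _ x _ => ?_⟩⟩
  rcases Nat.eq_zero_or_pos k with rfl | hk
  · simp
  · simp [iteratedFDeriv_const_of_ne hk.ne']

theorem IsModerate.add {Ω : TopologicalSpace.Opens (Eucl n)} {u v : Param → Eucl n → ℂ}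
    (hu : IsModerate Ω u) (hv : IsModerate Ω v) : IsModerate Ω (u + v) := by
  refine ⟨fun ε => (hu.1 ε).add (hv.1 ε), fun K hK hKΩ k => ?_⟩
  obtain ⟨N, hN⟩ := hu.2 K hK hKΩ k
  obtain ⟨N', hN'⟩ := hv.2 K hK hKΩ k
  exact ⟨max N N', DerivBound.add hKΩ hu.1 hv.1 (hN.mono (by omega)) (hN'.mono (by omega))⟩

theorem IsModerate.mul {Ω : TopologicalSpace.Opens (Eucl n)} {u v : Param → Eucl n → ℂ}
    (hu : IsModerate Ω u) (hv : IsModerate Ω v) : IsModerate Ω (u * v) := by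
  refine ⟨fun ε => (hu.1 ε).mul (hv.1 ε), fun K hK hKΩ k => ?_⟩
  obtain ⟨N, hN⟩ := hu.uniform hK hKΩ k
  obtain ⟨N', hN'⟩ := hv.uniform hK hKΩ k
  exact ⟨N + N', (DerivBound.mul hKΩ hu.1 hv.1 hN hN').mono (by omega)⟩

theorem DerivBound.partialDeriv {Ω : TopologicalSpace.Opens (Eucl n)} {K : Set (Eucl n)} {k : ℕ}
    {p : ℤ} {u : Param → Eucl n → ℂ} (hK : K ⊆ Ω) (hu : ∀ ε, ContDiffOn ℝ ∞ (u ε) Ω)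
    (h : DerivBound K (k + 1) p u) (i : Fin n) :
    DerivBound K k p (fun ε => partialDeriv i (u ε)) := by
  obtain ⟨C, e, he, h⟩ := h
  refine ⟨C, e, he, fun ε hε x hx => le_trans ?_ (h ε hε x hx)⟩
  have hd : ContDiffAt ℝ ∞ (fderiv ℝ (u ε)) x :=
    ((hu ε).contDiffAt (Ω.isOpen.mem_nhds (hK hx))).fderiv_right (by simp)
  have := norm_iteratedFDeriv_clm_apply_const (c := (EuclideanSpace.single i 1 : Eucl n))
    (n := k) hd (by exact_mod_cast le_top)
  have hn : ‖(EuclideanSpace.single i 1 : Eucl n)‖ = 1 := by simp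
  rw [norm_iteratedFDeriv_fderiv, hn, one_mul] at this
  exact this

theorem contDiffOn_partialDeriv {Ω : TopologicalSpace.Opens (Eucl n)} {f : Eucl n → ℂ}
    (hf : ContDiffOn ℝ ∞ f Ω) (i : Fin n) : ContDiffOn ℝ ∞ (partialDeriv i f) Ω :=
  (hf.fderiv_of_isOpen Ω.isOpen (by simp)).clm_apply contDiffOn_const

theorem IsModerate.partialDeriv {Ω : TopologicalSpace.Opens (Eucl n)} {u : Param → Eucl n → ℂ}
    (hu : IsModerate Ω u) (i : Fin n) : IsModerate Ω (fun ε => partialDeriv i (u ε)) := by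
  refine ⟨fun ε => contDiffOn_partialDeriv (hu.1 ε) i, fun K hK hKΩ k => ?_⟩
  obtain ⟨N, hN⟩ := hu.2 K hK hKΩ (k + 1)
  exact ⟨N, hN.partialDeriv hKΩ hu.1 i⟩

/-- The algebra of moderate nets of smooth functions on `Ω`. -/
def Moderate (Ω : TopologicalSpace.Opens (Eucl n)) : Subalgebra ℂ (Param → Eucl n → ℂ) where
  carrier := {u | IsModerate Ω u}
  mul_mem' := IsModerate.mul
  add_mem' := IsModerate.add
  algebraMap_mem' c := isModerate_const Ω c

/-- The ideal of negligible nets. -/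
def Negligible (Ω : TopologicalSpace.Opens (Eucl n)) : Ideal (Moderate Ω) where
  carrier := {u | IsNegligible Ω (u : Param → Eucl n → ℂ)}
  add_mem' {u v} hu hv := fun K hK hKΩ k q =>
    DerivBound.add hKΩ u.2.1 v.2.1 (hu K hK hKΩ k q) (hv K hK hKΩ k q)
  zero_mem' := fun K _ _ k q => ⟨0, 1, one_pos, fun ε _ x _ => by
    have : iteratedFDeriv ℝ k (((0 : Moderate Ω) : Param → Eucl n → ℂ) ε) x = 0 := by
      have h0 : ((0 : Moderate Ω) : Param → Eucl n → ℂ) ε = fun _ => 0 := rfl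
      rw [h0, iteratedFDeriv_fun_zero]; rfl
    rw [this]; simp⟩
  smul_mem' a u hu := fun K hK hKΩ k q => by
    obtain ⟨N, hN⟩ := IsModerate.uniform a.2 hK hKΩ k
    exact (DerivBound.mul (q := ((q + N : ℕ) : ℤ)) hKΩ a.2.1 u.2.1 hN
      (fun j _ => hu K hK hKΩ j _)).mono (by push_cast; omega)

/-- The (special) Colombeau algebra `𝒢(Ω)` of generalized functions: moderate nets modulo
negligible nets. -/
abbrev GenFun (Ω : TopologicalSpace.Opens (Eucl n)) : Type := Moderate Ω ⧸ Negligible Ω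

/-- The class in `𝒢(Ω)` of a moderate net. -/
def GenFun.mk {Ω : TopologicalSpace.Opens (Eucl n)} (u : Moderate Ω) : GenFun Ω :=
  Ideal.Quotient.mk (Negligible Ω) u

/-- `∂ᵢ` on moderate nets. -/
def Moderate.partialDeriv {Ω : TopologicalSpace.Opens (Eucl n)} (i : Fin n) (u : Moderate Ω) :
    Moderate Ω :=
  ⟨fun ε => Colombeau.partialDeriv i (u.1 ε), IsModerate.partialDeriv u.2 i⟩

theorem Moderate.partialDeriv_rel {Ω : TopologicalSpace.Opens (Eucl n)} (i : Fin n)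
    (u v : Moderate Ω) (h : u - v ∈ Negligible Ω) :
    Moderate.partialDeriv i u - Moderate.partialDeriv i v ∈ Negligible Ω := by
  intro K hK hKΩ k q
  obtain ⟨C, e, he, h1⟩ := DerivBound.partialDeriv hKΩ (u - v).2.1 (h K hK hKΩ (k + 1) q) i
  refine ⟨C, e, he, fun ε hε x hx => le_trans (le_of_eq ?_) (h1 ε hε x hx)⟩
  congr 1
  have hloc : (((Moderate.partialDeriv i u - Moderate.partialDeriv i v : Moderate Ω) :
      Param → Eucl n → ℂ) ε) =ᶠ[nhds x]
      Colombeau.partialDeriv i (((u - v : Moderate Ω) : Param → Eucl n → ℂ) ε) := by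
    filter_upwards [Ω.isOpen.mem_nhds (hKΩ hx)] with y hy
    have hu : DifferentiableAt ℝ (u.1 ε) y :=
      ((u.2.1 ε).contDiffAt (Ω.isOpen.mem_nhds hy)).differentiableAt (by simp)
    have hv : DifferentiableAt ℝ (v.1 ε) y :=
      ((v.2.1 ε).contDiffAt (Ω.isOpen.mem_nhds hy)).differentiableAt (by simp)
    have : fderiv ℝ (u.1 ε - v.1 ε) y = fderiv ℝ (u.1 ε) y - fderiv ℝ (v.1 ε) y :=
      fderiv_sub hu hv
    change _ = fderiv ℝ (u.1 ε - v.1 ε) y (EuclideanSpace.single i 1)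
    rw [this]
    rfl
  exact (Filter.EventuallyEq.iteratedFDeriv ℝ hloc k).eq_of_nhds

/-- The operator `∂ᵢ` on `𝒢(Ω)`. -/
def GenFun.partialDeriv {Ω : TopologicalSpace.Opens (Eucl n)} (i : Fin n) :
    GenFun Ω → GenFun Ω :=
  Quotient.map' (Moderate.partialDeriv i) fun u v h => by
    rw [Submodule.quotientRel_def] at h ⊢
    exact Moderate.partialDeriv_rel i u v h

theorem GenFun.partialDeriv_mk {Ω : TopologicalSpace.Opens (Eucl n)} (i : Fin n)
    (u : Moderate Ω) :
    GenFun.partialDeriv i (GenFun.mk u) = GenFun.mk (Moderate.partialDeriv i u) := rfl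

/-- The operator `Dᵢ = -i ∂ᵢ` on `𝒢(Ω)`. -/
def GenFun.D {Ω : TopologicalSpace.Opens (Eucl n)} (i : Fin n) (u : GenFun Ω) : GenFun Ω :=
  (-Complex.I) • GenFun.partialDeriv i u

/-! ### Partial differential operators -/

/-- A family `P_ε(x, D) = ∑_{|α| ≤ m} a_α^ε(x) D^α` of partial differential operators of order
`m` on `Ω` whose coefficients `(a_α^ε)_ε` represent generalized functions. -/
structure DiffOp (Ω : TopologicalSpace.Opens (Eucl n)) (m : ℕ) where
  /-- The representatives of the coefficients (only those with `|α| ≤ m` are used). -/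
  coeff : (Fin n → ℕ) → Moderate Ω

/-- The operator `P : 𝒢(Ω) → 𝒢(Ω)`, `P u = ∑_{|α| ≤ m} a_α D^α u`. -/
def DiffOp.apply {Ω : TopologicalSpace.Opens (Eucl n)} {m : ℕ} (P : DiffOp Ω m) (u : GenFun Ω) :
    GenFun Ω :=
  ∑ α ∈ multiIndices n m, GenFun.mk (P.coeff α) * multiPow GenFun.D α u

/-- The symbol `P_ε(x, ξ) = ∑_{|α| ≤ m} a_α^ε(x) ξ^α`. -/
def DiffOp.symbol {Ω : TopologicalSpace.Opens (Eucl n)} {m : ℕ} (P : DiffOp Ω m) (ε : Param)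
    (x ξ : Eucl n) : ℂ :=
  ∑ α ∈ multiIndices n m, (P.coeff α).1 ε x * ∏ i, ((ξ i : ℝ) : ℂ) ^ α i

/-- The derivative `∂_x^α ∂_ξ^β P_ε(x, ξ)` of the symbol. -/
def DiffOp.symbolDeriv {Ω : TopologicalSpace.Opens (Eucl n)} {m : ℕ} (P : DiffOp Ω m)
    (α β : Fin n → ℕ) (ε : Param) (x ξ : Eucl n) : ℂ :=
  multiDeriv α (fun y => multiDeriv β (fun η => P.symbol ε y η) ξ) x

/-! ### The wave front set -/

/-- A subset of `ℝⁿ` is conic if it is stable under multiplication by positive scalars. -/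
def IsConic (Γ : Set (Eucl n)) : Prop := ∀ ξ ∈ Γ, ∀ t : ℝ, 0 < t → t • ξ ∈ Γ

/-- The Fourier transform `(φ u_ε)^(ξ) = ∫ φ(x) u_ε(x) e^{-iξx} dx` of a cut-off net. -/
def cutoffFourier {Ω : TopologicalSpace.Opens (Eucl n)} (φ : 𝓓(Ω, ℂ)) (u : Moderate Ω)
    (ε : Param) (ξ : Eucl n) : ℂ :=
  ∫ x : Eucl n, φ x * u.1 ε x * Complex.exp (-(Complex.I * ((inner ℝ ξ x : ℝ) : ℂ)))

/-- A net of functions is rapidly decreasing in `Γ`; the power of `1/ε` does not depend on the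
order of decrease. -/
def RapidlyDecreasing (Γ : Set (Eucl n)) (g : Param → Eucl n → ℂ) : Prop :=
  ∃ M : ℕ, ∀ l : ℕ, ∃ C : ℝ, 0 < C ∧ ∃ ε₀ : ℝ, 0 < ε₀ ∧ ε₀ < 1 ∧
    ∀ ξ ∈ Γ, ∀ ε : Param, (ε : ℝ) < ε₀ →
      ‖g ε ξ‖ ≤ C * (ε : ℝ) ^ (-(M : ℤ)) * (1 + ‖ξ‖) ^ (-(l : ℤ))

/-- `u ∈ 𝒢(Ω)` is microlocally regular at `(x, ξ)`: for some test function `φ` on `Ω` with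
`φ(x) ≠ 0`, the Fourier transform of `φ u` is rapidly decreasing in some open conic neighbourhood
of `ξ`. (Negligible nets have `(φ u_ε)^(ξ) = O(ε^q (1 + |ξ|)^{-l})` for all `q` and `l`, so the
choice of the representative does not matter.) -/
def MicroRegularAt {Ω : TopologicalSpace.Opens (Eucl n)} (u : GenFun Ω) (x ξ : Eucl n) : Prop :=
  ∃ v : Moderate Ω, GenFun.mk v = u ∧ ∃ φ : 𝓓(Ω, ℂ), φ x ≠ 0 ∧
    ∃ Γ : Set (Eucl n), IsOpen Γ ∧ IsConic Γ ∧ ξ ∈ Γ ∧ RapidlyDecreasing Γ (cutoffFourier φ v)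

/-- The cotangent bundle of `Ω` without its zero section, `Ω × (ℝⁿ ∖ {0})`. -/
def cotangent (Ω : TopologicalSpace.Opens (Eucl n)) : Set (Eucl n × Eucl n) :=
  {z | z.1 ∈ Ω ∧ z.2 ≠ 0}

/-- The generalized wave front set `WF_g(u)`. -/
def waveFrontSet {Ω : TopologicalSpace.Opens (Eucl n)} (u : GenFun Ω) :
    Set (Eucl n × Eucl n) :=
  {z | z ∈ cotangent Ω ∧ ¬ MicroRegularAt u z.1 z.2}

/-! ### The microlocal hypoellipticity conditions -/

/-- A net of positive numbers is of slow scale if each of its powers is eventually at most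
`1/ε`. -/
def SlowScale (r : Param → ℝ) : Prop :=
  (∀ ε, 0 < r ε) ∧ ∀ p : ℕ, ∃ ε₀ : ℝ, 0 < ε₀ ∧ ∀ ε : Param, (ε : ℝ) < ε₀ → r ε ^ p ≤ (ε : ℝ)⁻¹

/-- The lower bound `|P_ε(x, ξ)| ≥ ε^q (1 + |ξ|)^{m₀}` over the part of `Λ` above `K`. -/
def LowerBound {Ω : TopologicalSpace.Opens (Eucl n)} {m : ℕ} (P : DiffOp Ω m)
    (Λ : Set (Eucl n × Eucl n)) (m₀ : ℝ) (K : Set (Eucl n)) : Prop :=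
  ∃ q : ℝ, 0 < q ∧ ∃ r : Param → ℝ, SlowScale r ∧ ∃ ε₀ : ℝ, 0 < ε₀ ∧
    ∀ x ξ : Eucl n, x ∈ K → (x, ξ) ∈ Λ → ∀ ε : Param, (ε : ℝ) < ε₀ → r ε ≤ ‖ξ‖ →
      (ε : ℝ) ^ q * (1 + ‖ξ‖) ^ m₀ ≤ ‖P.symbol ε x ξ‖

/-- The bounds `|∂_x^α ∂_ξ^β P_ε(x, ξ)| ≤ s_ε^α |P_ε(x, ξ)| (1 + |ξ|)^{δ|α| - ρ|β|}` over the part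
of `Λ` above `K`. -/
def SymbolBounds {Ω : TopologicalSpace.Opens (Eucl n)} {m : ℕ} (P : DiffOp Ω m)
    (Λ : Set (Eucl n × Eucl n)) (δ ρ : ℝ) (K : Set (Eucl n)) : Prop :=
  ∀ α : Fin n → ℕ, ∃ s r : Param → ℝ, SlowScale s ∧ SlowScale r ∧ ∃ ε₀ : ℝ, 0 < ε₀ ∧
    ∀ β : Fin n → ℕ, len β ≤ m →
      ∀ x ξ : Eucl n, x ∈ K → (x, ξ) ∈ Λ → ∀ ε : Param, (ε : ℝ) < ε₀ → r ε ≤ ‖ξ‖ →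
        ‖P.symbolDeriv α β ε x ξ‖ ≤
          s ε * ‖P.symbol ε x ξ‖ * (1 + ‖ξ‖) ^ (δ * (len α : ℝ) - ρ * (len β : ℝ))

/-- `P` satisfies the microlocal hypoellipticity conditions on `Λ`, with exponents that depend
only on `Λ`, uniformly over each compact subset `K` of the base projection of `Λ`. For
`Λ = U × Γ` the base projection is `U`, and the estimates are required on `K × Γ`. -/
def MicroHypoellipticOn {Ω : TopologicalSpace.Opens (Eucl n)} {m : ℕ} (P : DiffOp Ω m)
    (Λ : Set (Eucl n × Eucl n)) : Prop :=
  ∃ m₀ δ ρ : ℝ, 0 ≤ δ ∧ δ < ρ ∧ ρ ≤ 1 ∧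
    ∀ K : Set (Eucl n), IsCompact K → K ⊆ Prod.fst '' Λ →
      LowerBound P Λ m₀ K ∧ SymbolBounds P Λ δ ρ K

/-- An open subset of `Ω × (ℝⁿ ∖ {0})` that is conic in the second variable. -/
def IsOpenConic (Ω : TopologicalSpace.Opens (Eucl n)) (Λ : Set (Eucl n × Eucl n)) : Prop :=
  IsOpen Λ ∧ Λ ⊆ cotangent Ω ∧ ∀ x ξ : Eucl n, (x, ξ) ∈ Λ → ∀ t : ℝ, 0 < t → (x, t • ξ) ∈ Λ

/-- The set `M_g(P)`: the union of all open conic sets on which `P` satisfies the microlocal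
hypoellipticity conditions. -/
def microHypoellipticSet {Ω : TopologicalSpace.Opens (Eucl n)} {m : ℕ} (P : DiffOp Ω m) :
    Set (Eucl n × Eucl n) :=
  ⋃₀ {Λ | IsOpenConic Ω Λ ∧ MicroHypoellipticOn P Λ}

end Colombeau

end

noncomputable section

namespace Colombeau

variable {n : ℕ}

/-! ### Smooth functions on `ℝⁿ` -/

/-! The proof builds a parametrix acting on test functions. Conjugating the transpose of `P` with
the exponential gives `L h = e^{ixξ} ᵗP(e^{-ixξ} h)`, a sum over `β` of `(1/β!) (-D)^β (∂_ξ^β p ·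
h)` whose term `β = 0` is multiplication by the symbol `p` (`sum_revPow_A`). Where `p p' = 1` this
reads `L(p' h) = h - R h`, so the finite Neumann sum telescopes: `L(p' (ψ + Rψ + ⋯ + R^{N-1}ψ)) = ψ
- R^N ψ` (`transposed_neumannSum`). Integration by parts then splits the Fourier transform of `ψ u`
into an integral of `P u` against `e^{-ixξ} p' (ψ + ⋯ + R^{N-1}ψ)` and an integral of `u` against
`e^{-ixξ} R^N ψ`.

The definition of rapid decrease requires a power of `1/ε` that is the same for all orders of
decrease. The hypoellipticity bounds on `∂_x^α ∂_ξ^β p / p` lose only slow scale factors, and these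
are smaller than every `ε^{-η}`. Hence each application of `R` gains `(1+|ξ|)^{-(ρ-δ)}` while the
accumulated loss in `ε` stays arbitrarily small (`symbolClass_iterate_remainder`). The lower bound
on `p` is used for a single factor `p'`, and costs `ε^{-q}` once (`symbolClass_inv`). `SymbolClass`
encodes this by asking for estimates with every exponent `q' > q`.

The `R^N ψ` integral is estimated in absolute value, with `N` large. In the `P u` integral, the
Fourier transform of `φ P u` is convolved with that of a symbol (`integral_mul_expo_mul_le`): near
`ξ` the former decays rapidly, and far from `ξ` the latter does, since `k` derivatives cost only
`(1+|ξ|)^{δk}` and `δ < 1`. Both estimates hold for `|ξ|` above a slow scale net; below it,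
moderateness suffices at the price of one more factor `1/ε` (`rapidlyDecreasing_of_tailFilter`). -/

/-- The algebra of smooth functions on `ℝⁿ`. -/
def Smooth (n : ℕ) : Subalgebra ℂ (Eucl n → ℂ) where
  carrier := {f | ContDiff ℝ ∞ f}
  mul_mem' {f g} (hf : ContDiff ℝ ∞ f) (hg : ContDiff ℝ ∞ g) :=
    show ContDiff ℝ ∞ fun x => f x * g x from hf.mul hg
  add_mem' {f g} (hf : ContDiff ℝ ∞ f) (hg : ContDiff ℝ ∞ g) :=
    show ContDiff ℝ ∞ fun x => f x + g x from hf.add hg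
  algebraMap_mem' c := show ContDiff ℝ ∞ fun _ => c from contDiff_const

namespace Smooth

instance : CoeFun (Smooth n) fun _ => Eucl n → ℂ := ⟨Subtype.val⟩

theorem contDiff (f : Smooth n) : ContDiff ℝ ∞ (f : Eucl n → ℂ) := f.2

theorem differentiable (f : Smooth n) : Differentiable ℝ (f : Eucl n → ℂ) :=
  (Smooth.contDiff f).differentiable (by simp)

theorem continuous (f : Smooth n) : Continuous (f : Eucl n → ℂ) := (Smooth.contDiff f).continuous

@[ext] theorem ext {f g : Smooth n} (h : ∀ x, f x = g x) : f = g := Subtype.ext (funext h)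

@[simp] theorem add_apply (f g : Smooth n) (x : Eucl n) : (f + g) x = f x + g x := rfl
@[simp] theorem sub_apply (f g : Smooth n) (x : Eucl n) : (f - g) x = f x - g x := rfl
@[simp] theorem neg_apply (f : Smooth n) (x : Eucl n) : (-f) x = -f x := rfl
@[simp] theorem mul_apply (f g : Smooth n) (x : Eucl n) : (f * g) x = f x * g x := rfl
@[simp] theorem smul_apply (c : ℂ) (f : Smooth n) (x : Eucl n) : (c • f) x = c * f x := rfl
@[simp] theorem zero_apply (x : Eucl n) : (0 : Smooth n) x = 0 := rfl

@[simp] theorem sum_apply {ι : Type*} (s : Finset ι) (f : ι → Smooth n) (x : Eucl n) :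
    (∑ i ∈ s, f i) x = ∑ i ∈ s, f i x := by
  induction s using Finset.cons_induction with
  | empty => simp
  | cons a s ha ih => simp [Finset.sum_cons, ih]

/-- The partial derivative `∂ᵢ` on smooth functions. -/
def d (i : Fin n) : Smooth n →ₗ[ℂ] Smooth n where
  toFun f := ⟨partialDeriv i f, ((Smooth.contDiff f).fderiv_right (m := ∞) (by simp)).clm_apply
    contDiff_const⟩
  map_add' f g := by
    ext x
    change fderiv ℝ ((f : Eucl n → ℂ) + (g : Eucl n → ℂ)) x _ = fderiv ℝ f x _ + fderiv ℝ g x _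
    rw [fderiv_add (Smooth.differentiable f x) (Smooth.differentiable g x)]
    rfl
  map_smul' c f := by
    ext x
    change fderiv ℝ (c • (f : Eucl n → ℂ)) x _ = c * fderiv ℝ f x _
    rw [fderiv_const_smul (Smooth.differentiable f x)]
    rfl

theorem d_apply (i : Fin n) (f : Smooth n) (x : Eucl n) :
    d i f x = fderiv ℝ f x (EuclideanSpace.single i 1) := rfl

theorem d_mul (i : Fin n) (f g : Smooth n) : d i (f * g) = d i f * g + f * d i g := by
  ext x
  have : fderiv ℝ ((f : Eucl n → ℂ) * (g : Eucl n → ℂ)) x = _ :=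
    fderiv_mul (Smooth.differentiable f x) (Smooth.differentiable g x)
  change fderiv ℝ ((f : Eucl n → ℂ) * (g : Eucl n → ℂ)) x _ = _
  rw [this]
  simp [d_apply]
  ring

theorem d_comm (i j : Fin n) (f : Smooth n) : d i (d j f) = d j (d i f) := by
  have key : ∀ (i j : Fin n) (x : Eucl n), d i (d j f) x =
      fderiv ℝ (fderiv ℝ f) x (EuclideanSpace.single i 1) (EuclideanSpace.single j 1) := by
    intro i j x
    have hd : DifferentiableAt ℝ (fderiv ℝ (f : Eucl n → ℂ)) x :=
      (((Smooth.contDiff f).fderiv_right (m := ∞) (by simp)).differentiable (by simp)) x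
    change fderiv ℝ (fun y => fderiv ℝ f y (EuclideanSpace.single j 1)) x _ = _
    rw [fderiv_clm_apply hd (differentiableAt_const _)]
    simp
  ext x
  rw [key, key]
  have : IsSymmSndFDerivAt ℝ (f : Eucl n → ℂ) x :=
    (Smooth.contDiff f).contDiffAt.isSymmSndFDerivAt (by simpa using (WithTop.coe_le_coe.2 le_top : ((2 : ℕ∞) : WithTop ℕ∞) ≤ ∞))
  exact this _ _

theorem d_eqOn {V : Set (Eucl n)} (hV : IsOpen V) {f : Eucl n → ℂ} {F : Smooth n}
    (h : Set.EqOn F f V) (i : Fin n) : Set.EqOn (d i F) (partialDeriv i f) V := by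
  intro x hx
  have : (F : Eucl n → ℂ) =ᶠ[nhds x] f := Filter.eventuallyEq_of_mem (hV.mem_nhds hx) h
  rw [d_apply, this.fderiv_eq]
  rfl

theorem d_eq_zero {V : Set (Eucl n)} (hV : IsOpen V) {F : Smooth n}
    (h : ∀ x ∈ V, F x = 0) (i : Fin n) : ∀ x ∈ V, d i F x = 0 := by
  intro x hx
  rw [d_eqOn hV (f := fun _ => 0) h i hx]
  simp [partialDeriv]

end Smooth

/-- A general transfer principle: a relation respected by each single operator is respected by their
powers. It serves for restriction to open sets, passage to classes in `GenFun` and linearity. -/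
theorem multiPow_rel {X Y : Type*} {d : Fin n → X → X} {d' : Fin n → Y → Y} (r : X → Y → Prop)
    (h : ∀ i x y, r x y → r (d i x) (d' i y)) (α : Fin n → ℕ) {x : X} {y : Y} (hxy : r x y) :
    r (multiPow d α x) (multiPow d' α y) := by
  unfold multiPow
  induction List.finRange n with
  | nil => exact hxy
  | cons i l ih =>
    simp only [List.foldr_cons]
    induction α i with
    | zero => exact ih
    | succ k hk => rw [Function.iterate_succ_apply', Function.iterate_succ_apply']; exact h _ _ _ hk

/-- Commutativity lets the extra factor move inwards past the other operators to its own place in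
the ordered composition. -/
theorem apply_multiPow {X : Type*} {d : Fin n → X → X} (hd : ∀ i j x, d i (d j x) = d j (d i x))
    (α : Fin n → ℕ) (i : Fin n) (x : X) :
    d i (multiPow d α x) = multiPow d (α + Pi.single i 1) x := by
  -- For sublists the extra factor appears only once the index `i` has been met.
  have key : ∀ l : List (Fin n), l.Nodup →
      l.foldr (fun j v => (d j)^[(α + Pi.single i 1 : Fin n → ℕ) j] v) x =
        if i ∈ l then d i (l.foldr (fun j v => (d j)^[α j] v) x)
        else l.foldr (fun j v => (d j)^[α j] v) x := by
    intro l
    induction l with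
    | nil => intro _; simp
    | cons j l ih =>
      intro hl
      rw [List.nodup_cons] at hl
      simp only [List.foldr_cons, ih hl.2]
      by_cases hij : i = j
      · subst hij
        simp [hl.1, Function.iterate_succ_apply']
      · have : (α + Pi.single i 1 : Fin n → ℕ) j = α j := by simp [Ne.symm hij]
        rw [this]
        by_cases hil : i ∈ l
        · simp only [hil, List.mem_cons, or_true, if_true]
          exact (((show Function.Commute (d i) (d j) from hd i j).iterate_right (α j)).eq _).symm
        · simp [hil, hij]
  have := key (List.finRange n) (List.nodup_finRange n)
  rw [if_pos (List.mem_finRange i)] at this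
  exact this.symm

theorem multiDeriv_eqOn {V : Set (Eucl n)} (hV : IsOpen V) {f : Eucl n → ℂ} {F : Smooth n}
    (h : Set.EqOn F f V) (α : Fin n → ℕ) :
    Set.EqOn (multiPow (fun i => Smooth.d i) α F : Smooth n) (multiDeriv α f) V :=
  multiPow_rel (fun (F : Smooth n) f => Set.EqOn F f V) (fun i _ _ h => Smooth.d_eqOn hV h i) α h

/-- A smooth function on a neighbourhood of a closed ball coincides on the ball of half the
radius with a globally smooth function. -/
theorem exists_smooth_eqOn {U : Set (Eucl n)} (hU : IsOpen U) {f : Eucl n → ℂ}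
    (hf : ContDiffOn ℝ ∞ f U) {x₀ : Eucl n} {R : ℝ} (hR : 0 < R)
    (h : Metric.closedBall x₀ R ⊆ U) :
    ∃ F : Smooth n, Set.EqOn F f (Metric.ball x₀ (R / 2)) := by
  let χ : ContDiffBump x₀ := ⟨R / 2, R, by positivity, by linarith⟩
  refine ⟨⟨fun x => (χ x : ℂ) * f x, show ContDiff ℝ ∞ _ from
    contDiff_iff_contDiffAt.2 fun x => ?_⟩, fun x hx => ?_⟩
  · by_cases hx : x ∈ tsupport χ
    · rw [χ.tsupport_eq] at hx
      exact (Complex.ofRealCLM.contDiff.comp χ.contDiff).contDiffAt.mul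
        (hf.contDiffAt (hU.mem_nhds (h hx)))
    · refine (contDiffAt_const (c := (0 : ℂ))).congr_of_eventuallyEq ?_
      filter_upwards [(isClosed_tsupport χ).isOpen_compl.mem_nhds hx] with y hy
      rw [image_eq_zero_of_notMem_tsupport hy]
      simp
  · change (χ x : ℂ) * f x = f x
    rw [χ.one_of_mem_closedBall (Metric.ball_subset_closedBall hx)]
    simp

/-- The product of a test function on `Ω` and a smooth function on `Ω`. -/
def cutoff {Ω : TopologicalSpace.Opens (Eucl n)} (φ : 𝓓(Ω, ℂ)) {f : Eucl n → ℂ}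
    (hf : ContDiffOn ℝ ∞ f Ω) : Smooth n :=
  ⟨fun x => φ x * f x, show ContDiff ℝ ∞ _ from contDiff_iff_contDiffAt.2 fun x => by
    by_cases hx : x ∈ tsupport φ
    · exact φ.contDiff.contDiffAt.mul
        (hf.contDiffAt (Ω.isOpen.mem_nhds (φ.tsupport_subset hx)))
    · refine (contDiffAt_const (c := (0 : ℂ))).congr_of_eventuallyEq ?_
      filter_upwards [(isClosed_tsupport φ).isOpen_compl.mem_nhds hx] with y hy
      rw [image_eq_zero_of_notMem_tsupport hy]
      simp⟩

theorem cutoff_apply {Ω : TopologicalSpace.Opens (Eucl n)} (φ : 𝓓(Ω, ℂ)) {f : Eucl n → ℂ}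
    (hf : ContDiffOn ℝ ∞ f Ω) (x : Eucl n) : cutoff φ hf x = φ x * f x := rfl

/-! ### Exponentials and integration by parts -/

/-- The exponential `x ↦ e^{-iξx}`. -/
def expo (ξ : Eucl n) : Smooth n :=
  ⟨fun x => Complex.exp (-(Complex.I * ((inner ℝ ξ x : ℝ) : ℂ))), by
    have h : ContDiff ℝ ∞ fun x : Eucl n => ((inner ℝ ξ x : ℝ) : ℂ) :=
      Complex.ofRealCLM.contDiff.comp (contDiff_const.inner ℝ contDiff_id)
    exact ((contDiff_const.mul h).neg).cexp⟩

theorem expo_apply (ξ x : Eucl n) :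
    expo ξ x = Complex.exp (-(Complex.I * ((inner ℝ ξ x : ℝ) : ℂ))) := rfl

theorem norm_expo (ξ x : Eucl n) : ‖expo ξ x‖ = 1 := by
  rw [expo_apply, Complex.norm_exp]
  simp

theorem d_expo (i : Fin n) (ξ : Eucl n) :
    Smooth.d i (expo ξ) = (-(Complex.I * (ξ i : ℂ))) • expo ξ := by
  ext x
  have h1 : HasFDerivAt (fun x : Eucl n => ((inner ℝ ξ x : ℝ) : ℂ))
      (Complex.ofRealCLM.comp (innerSL ℝ ξ)) x :=
    Complex.ofRealCLM.hasFDerivAt.comp x (innerSL ℝ ξ).hasFDerivAt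
  have h2 : HasFDerivAt (fun x => Complex.exp (-(Complex.I * ((inner ℝ ξ x : ℝ) : ℂ)))) _ x :=
    ((h1.const_mul Complex.I).neg).cexp
  rw [Smooth.d_apply]
  change fderiv ℝ (fun x => Complex.exp (-(Complex.I * ((inner ℝ ξ x : ℝ) : ℂ)))) x _ = _
  rw [h2.fderiv]
  simp [expo_apply, EuclideanSpace.inner_single_right]
  ring

theorem integrable_mul_of_eq_zero {F : Set (Eucl n)} (hF : IsCompact F) (f g : Smooth n)
    (hg : ∀ x ∉ F, g x = 0) : MeasureTheory.Integrable (fun x => f x * g x) :=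
  ((Smooth.continuous f).mul (Smooth.continuous g)).integrable_of_hasCompactSupport
    (HasCompactSupport.intro hF fun x hx => by simp [hg x hx])

theorem integral_d_mul {F : Set (Eucl n)} (hF : IsCompact F) (f g : Smooth n)
    (hg : ∀ x ∉ F, g x = 0) (i : Fin n) :
    ∫ x, Smooth.d i f x * g x = -∫ x, f x * Smooth.d i g x := by
  have hg' := Smooth.d_eq_zero hF.isClosed.isOpen_compl (F := g) hg i
  rw [eq_neg_iff_add_eq_zero, add_comm, ← eq_neg_iff_add_eq_zero]
  exact integral_mul_fderiv_eq_neg_fderiv_mul_of_integrable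
    (integrable_mul_of_eq_zero hF (Smooth.d i f) g hg)
    (integrable_mul_of_eq_zero hF f (Smooth.d i g) hg')
    (integrable_mul_of_eq_zero hF f g hg)
    (fun x _ => Smooth.differentiable f x) (fun x _ => Smooth.differentiable g x)

/-! ### The transposed operator -/

/-- The distributive law in a noncommutative ring, keeping the order of the factors. Working with
ordered products avoids proving that the operators commute. -/
theorem reverse_prod_sum_smul {R ι : Type*} [Ring R] [Algebra ℂ R] [DecidableEq ι] {n : ℕ}
    (s : Fin n → Finset ι) (c : Fin n → ι → ℂ) (x : Fin n → ι → R) :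
    (List.ofFn fun i => ∑ j ∈ s i, c i j • x i j).reverse.prod =
      ∑ β ∈ Fintype.piFinset s, (∏ i, c i (β i)) • (List.ofFn fun i => x i (β i)).reverse.prod := by
  induction n with
  | zero => simp
  | succ n ih =>
    rw [List.ofFn_succ, List.reverse_cons, List.prod_append, List.prod_singleton,
      ih (fun i => s i.succ) (fun i => c i.succ) (fun i => x i.succ), Finset.sum_mul_sum,
      ← Finset.sum_product']
    refine Finset.sum_bij' (fun q _ => (Fin.cons q.2 q.1 : Fin (n + 1) → ι))
      (fun β _ => (fun i => β i.succ, β 0)) ?_ ?_ ?_ ?_ ?_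
    · intro q hq
      simp only [Finset.mem_product, Fintype.mem_piFinset] at hq ⊢
      exact Fin.cases hq.2 hq.1
    · intro β hβ
      simp only [Finset.mem_product, Fintype.mem_piFinset] at hβ ⊢
      exact ⟨fun i => hβ _, hβ 0⟩
    · intro q _
      simp
    · intro β _
      exact Fin.cons_self_tail β
    · intro q _
      simp [List.ofFn_succ, Fin.prod_univ_succ, smul_smul]

/-- The operator `Dᵢ = -i ∂ᵢ` on smooth functions. -/
def Smooth.D (i : Fin n) : Smooth n →ₗ[ℂ] Smooth n := (-Complex.I) • Smooth.d i

/-- The operator `i ∂ⱼ = -Dⱼ` on smooth functions. -/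
def Smooth.T (j : Fin n) : Module.End ℂ (Smooth n) := Complex.I • Smooth.d j

/-- The operator `ξⱼ - Dⱼ` on smooth functions. -/
def Smooth.A (ξ : Eucl n) (j : Fin n) : Module.End ℂ (Smooth n) := (ξ j : ℂ) • 1 + Smooth.T j

/-- The composition `d_n^αₙ ∘ ⋯ ∘ d_1^α₁`. -/
def revPow (d : Fin n → Module.End ℂ (Smooth n)) (α : Fin n → ℕ) : Module.End ℂ (Smooth n) :=
  (List.ofFn fun i => d i ^ α i).reverse.prod

theorem revPow_induction {r : ℕ → Smooth n → Prop} {d : Fin n → Module.End ℂ (Smooth n)}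
    (h : ∀ i k f, r k f → r (k + 1) (d i f)) (α : Fin n → ℕ) {k : ℕ} {f : Smooth n} (hf : r k f) :
    r (k + len α) (revPow d α f) := by
  have key : ∀ (l : List (Fin n)) (k : ℕ) (f : Smooth n), r k f →
      r (k + (l.map α).sum) ((l.map fun i => d i ^ α i).reverse.prod f) := by
    intro l
    induction l with
    | nil => intro k f hf; simpa using hf
    | cons i l ih =>
      intro k f hf
      simp only [List.map_cons, List.sum_cons, List.reverse_cons, List.prod_append,
        List.prod_singleton, ← add_assoc]
      refine ih _ _ ?_
      induction α i with
      | zero => simpa using hf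
      | succ j hj => rw [pow_succ', ← add_assoc]; exact h _ _ _ hj
  have := key (List.finRange n) k f hf
  rwa [← List.ofFn_eq_map, ← List.ofFn_eq_map, List.sum_ofFn] at this

theorem Smooth.T_eq_zero {V : Set (Eucl n)} (hV : IsOpen V) {f : Smooth n}
    (h : ∀ x ∈ V, f x = 0) (i : Fin n) : ∀ x ∈ V, Smooth.T i f x = 0 := by
  intro x hx
  change Complex.I * Smooth.d i f x = 0
  rw [Smooth.d_eq_zero hV h i x hx, mul_zero]

theorem Smooth.A_eq_zero {V : Set (Eucl n)} (hV : IsOpen V) (ξ : Eucl n) {f : Smooth n}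
    (h : ∀ x ∈ V, f x = 0) (i : Fin n) : ∀ x ∈ V, Smooth.A ξ i f x = 0 := by
  intro x hx
  change (ξ i : ℂ) * f x + Smooth.T i f x = 0
  rw [Smooth.T_eq_zero hV h i x hx, h x hx, mul_zero, add_zero]

/-- The transpose of `D` is `-D`, and `-D(e^{-ixξ} h) = e^{-ixξ} (ξ - D) h`. -/
theorem integral_D_mul_expo {F : Set (Eucl n)} (hF : IsCompact F) (f h : Smooth n)
    (hh : ∀ x ∉ F, h x = 0) (ξ : Eucl n) (i : Fin n) :
    ∫ x, Smooth.D i f x * (expo ξ x * h x) = ∫ x, f x * (expo ξ x * Smooth.A ξ i h x) := by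
  have h1 := integral_d_mul hF f (expo ξ * h) (fun x hx => by simp [hh x hx]) i
  calc ∫ x, Smooth.D i f x * (expo ξ x * h x)
      = ∫ x, (-Complex.I) * (Smooth.d i f x * (expo ξ * h) x) := by
        congr 1; ext x
        change (-Complex.I * Smooth.d i f x) * _ = _
        simp; ring
    _ = ∫ x, f x * (expo ξ x * Smooth.A ξ i h x) := by
        rw [MeasureTheory.integral_const_mul, h1, neg_mul_neg, ← MeasureTheory.integral_const_mul]
        congr 1; ext x
        rw [Smooth.d_mul, d_expo]
        change Complex.I * (f x * (-(Complex.I * (ξ i : ℂ)) * expo ξ x * h x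
          + expo ξ x * Smooth.d i h x)) =
          f x * (expo ξ x * ((ξ i : ℂ) * h x + Complex.I * Smooth.d i h x))
        linear_combination (-(ξ i : ℂ) * f x * expo ξ x * h x) * Complex.I_mul_I

/-- The outermost operator on `f` is the first to be moved onto `h`, so the order of composition is
reversed; this is why `revPow` occurs. -/
theorem integral_multiPow_D_mul_expo {F : Set (Eucl n)} (hF : IsCompact F) (f h : Smooth n)
    (hh : ∀ x ∉ F, h x = 0) (ξ : Eucl n) (α : Fin n → ℕ) :
    ∫ x, (multiPow (fun i => Smooth.D i) α f : Smooth n) x * (expo ξ x * h x) =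
      ∫ x, f x * (expo ξ x * revPow (Smooth.A ξ) α h x) := by
  have key : ∀ (l : List (Fin n)) (h : Smooth n), (∀ x ∉ F, h x = 0) →
      ∫ x, (l.foldr (fun i v => (Smooth.D i)^[α i] v) f : Smooth n) x * (expo ξ x * h x) =
      ∫ x, f x * (expo ξ x * (l.map fun i => Smooth.A ξ i ^ α i).reverse.prod h x) := by
    intro l
    induction l with
    | nil => intro h _; rfl
    | cons i l ih =>
      intro h hh
      simp only [List.foldr_cons, List.map_cons, List.reverse_cons, List.prod_append,
        List.prod_singleton]
      have step : ∀ k : ℕ, (∀ x ∉ F, (Smooth.A ξ i ^ k) h x = 0) ∧ ∀ g : Smooth n,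
          ∫ x, (Smooth.D i)^[k] g x * (expo ξ x * h x) =
            ∫ x, g x * (expo ξ x * (Smooth.A ξ i ^ k) h x) := by
        intro k
        induction k with
        | zero => exact ⟨hh, fun g => rfl⟩
        | succ k ihk =>
          rw [pow_succ']
          refine ⟨Smooth.A_eq_zero hF.isClosed.isOpen_compl ξ ihk.1 i, fun g => ?_⟩
          rw [Function.iterate_succ_apply, ihk.2, integral_D_mul_expo hF _ _ ihk.1]
          rfl
      rw [(step _).2, ih _ (step _).1]
      rfl
  have := key (List.finRange n) h hh
  rwa [← List.ofFn_eq_map] at this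

/-- The binomial formula for the commuting operators `ξᵢ` and `-Dᵢ`. The range is extended from `a`
to `m`, where the binomial coefficients vanish, so that one index set serves all exponents. -/
theorem A_pow (ξ : Eucl n) (i : Fin n) {a m : ℕ} (ha : a ≤ m) :
    Smooth.A ξ i ^ a = ∑ j ∈ Finset.range (m + 1),
      ((a.choose j : ℂ) * (ξ i : ℂ) ^ (a - j)) • Smooth.T i ^ j := by
  have hc : Commute (Smooth.T i) ((ξ i : ℂ) • (1 : Module.End ℂ (Smooth n))) :=
    (Commute.one_right _).smul_right _
  rw [Smooth.A, add_comm, hc.add_pow]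
  rw [← Finset.sum_subset (Finset.range_mono (Nat.succ_le_succ ha))]
  · refine Finset.sum_congr rfl fun j _ => ?_
    rw [smul_pow, one_pow, mul_smul_comm, mul_one, ← (Nat.cast_commute _ _).eq,
      ← nsmul_eq_mul, mul_smul, Nat.cast_smul_eq_nsmul]
  · intro j _ hj
    rw [Nat.choose_eq_zero_of_lt (by simpa using hj)]
    simp

theorem len_le_of_prod_choose_ne_zero {α β : Fin n → ℕ} (h : ∏ i, (α i).choose (β i) ≠ 0) :
    len β ≤ len α :=
  Finset.sum_le_sum fun i _ => by
    by_contra hlt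
    exact h (Finset.prod_eq_zero (Finset.mem_univ i) (Nat.choose_eq_zero_of_lt (by omega)))

theorem revPow_A (ξ : Eucl n) {α : Fin n → ℕ} {m : ℕ} (hα : α ∈ multiIndices n m) :
    revPow (Smooth.A ξ) α = ∑ β ∈ multiIndices n m,
      (∏ i, (((α i).choose (β i) : ℂ) * (ξ i : ℂ) ^ (α i - β i))) • revPow Smooth.T β := by
  have hle : ∀ i, α i ≤ m := fun i =>
    (Finset.single_le_sum (f := α) (fun _ _ => Nat.zero_le _) (Finset.mem_univ i)).trans
      (mem_multiIndices.1 hα)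
  unfold revPow
  have : (fun i => Smooth.A ξ i ^ α i) = fun i => ∑ j ∈ Finset.range (m + 1),
      (((α i).choose j : ℂ) * (ξ i : ℂ) ^ (α i - j)) • Smooth.T i ^ j :=
    funext fun i => A_pow ξ i (hle i)
  rw [this, reverse_prod_sum_smul (fun _ => Finset.range (m + 1))
    (fun i j => ((α i).choose j : ℂ) * (ξ i : ℂ) ^ (α i - j)) fun i j => Smooth.T i ^ j]
  symm
  refine Finset.sum_subset (Finset.filter_subset _ _) fun β hβ hβ' => ?_
  have : ∏ i, (α i).choose (β i) = 0 := by
    by_contra h0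
    exact hβ' (mem_multiIndices.2 ((len_le_of_prod_choose_ne_zero h0).trans
      (mem_multiIndices.1 hα)))
  rw [Finset.prod_mul_distrib, ← Nat.cast_prod, this]
  simp

/-- The derivative `∂_ξ^β p(·, ξ)` of the symbol with smooth coefficients `a`. -/
def smoothSymbol (m : ℕ) (a : (Fin n → ℕ) → Smooth n) (β : Fin n → ℕ) (ξ : Eucl n) : Smooth n :=
  ∑ α ∈ multiIndices n m,
    (∏ i, (((α i).descFactorial (β i) : ℂ) * (ξ i : ℂ) ^ (α i - β i))) • a α

/-- The operator `e^{ixξ} ᵗP (e^{-ixξ} h) = ∑_β (1/β!) (-D)^β (∂_ξ^β p(·, ξ) h)`. -/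
def transposed (m : ℕ) (a : (Fin n → ℕ) → Smooth n) (ξ : Eucl n) (h : Smooth n) : Smooth n :=
  ∑ β ∈ multiIndices n m,
    (∏ i, ((β i).factorial : ℂ))⁻¹ • revPow Smooth.T β (smoothSymbol m a β ξ * h)

theorem revPow_eq_zero {V : Set (Eucl n)} (hV : IsOpen V) (β : Fin n → ℕ) {f : Smooth n}
    (h : ∀ x ∈ V, f x = 0) : ∀ x ∈ V, revPow Smooth.T β f x = 0 :=
  revPow_induction (r := fun _ f => ∀ x ∈ V, f x = 0) (k := 0)
    (fun i _ _ hf => Smooth.T_eq_zero hV hf i) β h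

/-- By `descFactorial = factorial * choose`, the binomial coefficients from `revPow_A` are the
coefficients of `∂_ξ^β ξ^α` divided by `β!`. Exchanging the sums over `α` and `β` groups the terms
into derivatives of the symbol. -/
theorem sum_revPow_A (m : ℕ) (a : (Fin n → ℕ) → Smooth n) (ξ : Eucl n) (h : Smooth n) :
    ∑ α ∈ multiIndices n m, revPow (Smooth.A ξ) α (a α * h) = transposed m a ξ h := by
  unfold transposed smoothSymbol
  simp_rw [Finset.sum_mul, map_sum, Finset.smul_sum]
  rw [Finset.sum_comm]
  refine Finset.sum_congr rfl fun α hα => ?_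
  rw [revPow_A ξ hα, LinearMap.sum_apply]
  refine Finset.sum_congr rfl fun β _ => ?_
  rw [LinearMap.smul_apply, smul_mul_assoc, map_smul, smul_smul]
  congr 1
  rw [← Finset.prod_inv_distrib, ← Finset.prod_mul_distrib]
  refine Finset.prod_congr rfl fun i _ => ?_
  have : ((β i).factorial : ℂ) ≠ 0 := by exact_mod_cast (Nat.factorial_pos _).ne'
  rw [Nat.descFactorial_eq_factorial_mul_choose, Nat.cast_mul]
  field_simp

theorem integral_apply_mul_expo {F : Set (Eucl n)} (hF : IsCompact F) (m : ℕ)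
    (a : (Fin n → ℕ) → Smooth n) (v h : Smooth n) (hh : ∀ x ∉ F, h x = 0) (ξ : Eucl n) :
    ∫ x, (∑ α ∈ multiIndices n m, a α * multiPow (fun i => Smooth.D i) α v : Smooth n) x *
        (expo ξ x * h x) =
      ∫ x, v x * (expo ξ x * transposed m a ξ h x) := by
  have hah : ∀ α, ∀ x ∉ F, (a α * h) x = 0 := fun α x hx => by simp [hh x hx]
  have hint : ∀ (f g : Smooth n), (∀ x ∉ F, g x = 0) →
      MeasureTheory.Integrable fun x => f x * (expo ξ x * g x) := fun f g hg =>
    integrable_mul_of_eq_zero hF f (expo ξ * g) fun x hx => by simp [hg x hx]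
  rw [← sum_revPow_A]
  simp_rw [Smooth.sum_apply, Finset.mul_sum, Finset.sum_mul]
  rw [MeasureTheory.integral_finsetSum, MeasureTheory.integral_finsetSum]
  · refine Finset.sum_congr rfl fun α _ => ?_
    rw [← integral_multiPow_D_mul_expo hF v (a α * h) (hah α) ξ α]
    congr 1; ext x
    simp; ring
  · intro α _
    refine hint _ _ ?_
    exact revPow_induction (r := fun _ f => ∀ x ∉ F, f x = 0) (k := 0)
      (fun i _ _ hf => Smooth.A_eq_zero hF.isClosed.isOpen_compl ξ hf i) α (hah α)
  · intro α _
    exact hint _ _ hh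

/-! ### The derivatives of the symbol -/

/-- The monomial `ξ ↦ ξ^γ`. -/
def monomial (γ : Fin n → ℕ) : Smooth n :=
  ⟨fun η => ∏ i, ((η i : ℝ) : ℂ) ^ γ i, show ContDiff ℝ ∞ _ from contDiff_prod fun i _ =>
    (Complex.ofRealCLM.contDiff.comp (EuclideanSpace.proj (𝕜 := ℝ) i).contDiff).pow _⟩

theorem monomial_apply (γ : Fin n → ℕ) (η : Eucl n) :
    monomial γ η = ∏ i, ((η i : ℝ) : ℂ) ^ γ i := rfl

theorem d_monomial (i : Fin n) (γ : Fin n → ℕ) :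
    Smooth.d i (monomial γ) = (γ i : ℂ) • monomial (Function.update γ i (γ i - 1)) := by
  ext η
  have h0 : ∀ (γ : Fin n → ℕ) (η : Eucl n), monomial γ η =
      ((η i : ℝ) : ℂ) ^ γ i * ∏ j ∈ Finset.univ.erase i, ((η j : ℝ) : ℂ) ^ γ j := fun γ η =>
    (Finset.mul_prod_erase _ _ (Finset.mem_univ i)).symm
  rw [Smooth.d_apply, ← (Smooth.differentiable (monomial γ) η).lineDeriv_eq_fderiv, lineDeriv]
  have h1 : (fun t : ℝ => monomial γ (η + t • EuclideanSpace.single i (1 : ℝ))) =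
      fun t : ℝ => (((η i + t : ℝ)) : ℂ) ^ γ i *
        ∏ j ∈ Finset.univ.erase i, ((η j : ℝ) : ℂ) ^ γ j := by
    ext t
    rw [h0]
    congr 1
    · simp
    · refine Finset.prod_congr rfl fun j hj => ?_
      have : j ≠ i := Finset.ne_of_mem_erase hj
      simp [this]
  have h2 : HasDerivAt (fun t : ℝ => ((η i + t : ℝ) : ℂ)) 1 0 := by
    simpa using ((hasDerivAt_id (0 : ℝ)).const_add (η i)).ofReal_comp
  have h4 : HasDerivAt (fun t : ℝ => (((η i + t : ℝ)) : ℂ) ^ γ i *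
      ∏ j ∈ Finset.univ.erase i, ((η j : ℝ) : ℂ) ^ γ j) _ 0 := (h2.pow (γ i)).mul_const _
  rw [h1, h4.deriv, Smooth.smul_apply, h0]
  have h3 : ∏ j ∈ Finset.univ.erase i, ((η j : ℝ) : ℂ) ^ (Function.update γ i (γ i - 1)) j =
      ∏ j ∈ Finset.univ.erase i, ((η j : ℝ) : ℂ) ^ γ j :=
    Finset.prod_congr rfl fun j hj => by
      rw [Function.update_of_ne (Finset.ne_of_mem_erase hj)]
  rw [h3]
  simp
  ring

theorem iterate_d_monomial (i : Fin n) (γ : Fin n → ℕ) (k : ℕ) :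
    (Smooth.d i)^[k] (monomial γ) =
      ((γ i).descFactorial k : ℂ) • monomial (Function.update γ i (γ i - k)) := by
  induction k with
  | zero => simp
  | succ k ih =>
    rw [Function.iterate_succ_apply', ih, map_smul, d_monomial, smul_smul]
    simp [Nat.descFactorial_succ, mul_comm, Nat.sub_sub]

theorem iterate_d_smul (i : Fin n) (k : ℕ) (c : ℂ) (f : Smooth n) :
    (Smooth.d i)^[k] (c • f) = c • (Smooth.d i)^[k] f := by
  induction k with
  | zero => rfl
  | succ k ih => rw [Function.iterate_succ_apply', Function.iterate_succ_apply', ih, map_smul]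

theorem multiPow_d_monomial (α β : Fin n → ℕ) :
    multiPow (fun i => Smooth.d i) β (monomial α) =
      (∏ i, ((α i).descFactorial (β i) : ℂ)) • monomial (α - β) := by
  -- Halfway through the list, only the exponents at the indices already treated have been lowered.
  have key : ∀ l : List (Fin n), l.Nodup →
      l.foldr (fun j v => (Smooth.d j)^[β j] v) (monomial α) =
        (∏ i ∈ l.toFinset, ((α i).descFactorial (β i) : ℂ)) •
          monomial fun j => if j ∈ l then α j - β j else α j := by
    intro l
    induction l with
    | nil => intro _; simp
    | cons i l ih =>
      intro hl
      rw [List.nodup_cons] at hl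
      rw [List.foldr_cons, ih hl.2, iterate_d_smul, iterate_d_monomial, smul_smul,
        List.toFinset_cons, Finset.prod_insert (by simpa using hl.1), if_neg hl.1, mul_comm]
      congr 2
      ext j
      by_cases hj : j = i
      · subst hj; simp
      · simp [hj]
  have h := key (List.finRange n) (List.nodup_finRange n)
  rw [List.toFinset_finRange] at h
  simp only [List.mem_finRange, if_true] at h
  exact h

theorem multiPow_d_linear (β : Fin n → ℕ) {ι : Type*} (s : Finset ι) (c : ι → ℂ)
    (f : ι → Smooth n) :
    multiPow (fun i => Smooth.d i) β (∑ j ∈ s, c j • f j) =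
      ∑ j ∈ s, c j • multiPow (fun i => Smooth.d i) β (f j) :=
  multiPow_rel (X := Smooth n) (Y := ι → Smooth n) (d' := fun i g j => Smooth.d i (g j))
    (fun x g => x = ∑ j ∈ s, c j • g j)
    (fun i x g h => by simp [h, map_sum]) β (x := ∑ j ∈ s, c j • f j) (y := f) rfl |>.trans
  (Finset.sum_congr rfl fun j _ => by
    rw [multiPow_rel (fun (g : ι → Smooth n) x => g j = x) (d' := fun i => Smooth.d i)
      (fun i g x h => by simp [h]) β (x := f) (y := f j) rfl])

theorem multiDeriv_symbol {Ω : TopologicalSpace.Opens (Eucl n)} {m : ℕ} (P : DiffOp Ω m)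
    (β : Fin n → ℕ) (ε : Param) (x ξ : Eucl n) :
    multiDeriv β (fun η => P.symbol ε x η) ξ = ∑ α ∈ multiIndices n m,
      (∏ i, (((α i).descFactorial (β i) : ℂ) * (ξ i : ℂ) ^ (α i - β i))) *
        (P.coeff α).1 ε x := by
  have h : Set.EqOn (∑ α ∈ multiIndices n m, (P.coeff α).1 ε x • monomial α : Smooth n)
      (fun η => P.symbol ε x η) Set.univ := fun η _ => by
    simp [DiffOp.symbol, monomial_apply]
  rw [← multiDeriv_eqOn isOpen_univ h β (Set.mem_univ ξ), multiPow_d_linear]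
  simp only [Smooth.sum_apply, Smooth.smul_apply, multiPow_d_monomial, monomial_apply,
    Finset.prod_mul_distrib]
  refine Finset.sum_congr rfl fun α _ => ?_
  simp only [Pi.sub_apply]
  ring

/-- This lets the hypotheses on `P`, which concern coefficients smooth only on `Ω`, be read as
estimates on globally smooth functions over `V`. -/
theorem symbolDeriv_eqOn {Ω : TopologicalSpace.Opens (Eucl n)} {m : ℕ} (P : DiffOp Ω m)
    {V : Set (Eucl n)} (hV : IsOpen V) (ε : Param) {a : (Fin n → ℕ) → Smooth n}
    (ha : ∀ α, Set.EqOn (a α) ((P.coeff α).1 ε) V) (α β : Fin n → ℕ) (ξ : Eucl n) :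
    Set.EqOn (multiPow (fun i => Smooth.d i) α (smoothSymbol m a β ξ) : Smooth n)
      (fun x => P.symbolDeriv α β ε x ξ) V := by
  refine multiDeriv_eqOn hV (fun x hx => ?_) α
  rw [multiDeriv_symbol]
  simp only [smoothSymbol, Smooth.sum_apply, Smooth.smul_apply]
  exact Finset.sum_congr rfl fun γ _ => by rw [ha γ hx]

/-! ### Estimates up to slow scale nets -/

theorem SlowScale.max {r s : Param → ℝ} (hr : SlowScale r) (hs : SlowScale s) :
    SlowScale fun ε => max (r ε) (s ε) := by
  refine ⟨fun ε => lt_max_of_lt_left (hr.1 ε), fun p => ?_⟩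
  obtain ⟨a, ha, h⟩ := hr.2 p
  obtain ⟨b, hb, h'⟩ := hs.2 p
  refine ⟨min a b, lt_min ha hb, fun ε hε => ?_⟩
  dsimp only
  rcases le_total (r ε) (s ε) with hrs | hrs
  · rw [max_eq_right hrs]; exact h' ε (hε.trans_le (min_le_right _ _))
  · rw [max_eq_left hrs]; exact h ε (hε.trans_le (min_le_left _ _))

theorem slowScale_one : SlowScale fun _ => 1 :=
  ⟨fun _ => one_pos, fun p => ⟨1, one_pos, fun ε _ => by
    rw [one_pow]; exact (one_le_inv₀ ε.2.1).2 ε.2.2⟩⟩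

/-- The filter of the sets of pairs `(ε, ξ)` that contain all `(ε, ξ)` with `ξ ∈ Γ`, `|ξ| ≥ r_ε` and
`ε < ε₀`, for some slow scale net `r` and some `ε₀ > 0`. -/
def tailFilter (Γ : Set (Eucl n)) : Filter (Param × Eucl n) where
  sets := {S | ∃ r : Param → ℝ, SlowScale r ∧ ∃ ε₀ : ℝ, 0 < ε₀ ∧
    ∀ (ε : Param) (ξ : Eucl n), (ε : ℝ) < ε₀ → ξ ∈ Γ → r ε ≤ ‖ξ‖ → (ε, ξ) ∈ S}
  univ_sets := ⟨_, slowScale_one, 1, one_pos, fun _ _ _ _ _ => trivial⟩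
  sets_of_superset := fun ⟨r, hr, e, he, h⟩ hST =>
    ⟨r, hr, e, he, fun ε ξ h1 h2 h3 => hST (h ε ξ h1 h2 h3)⟩
  inter_sets := fun ⟨_, hr, e, he, h⟩ ⟨_, hr', e', he', h'⟩ =>
    ⟨_, hr.max hr', min e e', lt_min he he', fun ε ξ h1 h2 h3 =>
      ⟨h ε ξ (h1.trans_le (min_le_left _ _)) h2 ((le_max_left _ _).trans h3),
        h' ε ξ (h1.trans_le (min_le_right _ _)) h2 ((le_max_right _ _).trans h3)⟩⟩

theorem eventually_tailFilter {Γ : Set (Eucl n)} {p : Param × Eucl n → Prop} :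
    (∀ᶠ z in tailFilter Γ, p z) ↔ ∃ r : Param → ℝ, SlowScale r ∧ ∃ ε₀ : ℝ, 0 < ε₀ ∧
      ∀ (ε : Param) (ξ : Eucl n), (ε : ℝ) < ε₀ → ξ ∈ Γ → r ε ≤ ‖ξ‖ → p (ε, ξ) := Iff.rfl

theorem eventually_mem_tailFilter (Γ : Set (Eucl n)) : ∀ᶠ z in tailFilter Γ, z.2 ∈ Γ :=
  eventually_tailFilter.2 ⟨_, slowScale_one, 1, one_pos, fun _ _ _ h _ => h⟩

theorem eventually_lt_tailFilter (Γ : Set (Eucl n)) {ε₀ : ℝ} (h : 0 < ε₀) :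
    ∀ᶠ z in tailFilter Γ, (z.1 : ℝ) < ε₀ :=
  eventually_tailFilter.2 ⟨_, slowScale_one, ε₀, h, fun _ _ h _ _ => h⟩

theorem eventually_const_le (Γ : Set (Eucl n)) (C : ℝ) {η : ℝ} (hη : 0 < η) :
    ∀ᶠ z in tailFilter Γ, C ≤ (z.1 : ℝ) ^ (-η) := by
  have hC : 0 < |C| + 1 := by positivity
  filter_upwards [eventually_lt_tailFilter Γ (Real.rpow_pos_of_pos hC (-η⁻¹))] with z hz
  have h1 : ((|C| + 1) ^ (-η⁻¹)) ^ (-η) ≤ (z.1 : ℝ) ^ (-η) :=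
    Real.rpow_le_rpow_of_nonpos z.1.2.1 hz.le (by linarith)
  rw [← Real.rpow_mul hC.le, neg_mul_neg, inv_mul_cancel₀ hη.ne', Real.rpow_one] at h1
  linarith [le_abs_self C]

/-- With `p > 1/η`, the bound `s^p ≤ ε^{-1} ≤ ε^{-ηp}` gives the claim on taking `p`-th roots. This
is how slow scale factors become arbitrarily small losses. -/
theorem SlowScale.eventually_le {s : Param → ℝ} (hs : SlowScale s) (Γ : Set (Eucl n)) {η : ℝ}
    (hη : 0 < η) : ∀ᶠ z in tailFilter Γ, s z.1 ≤ (z.1 : ℝ) ^ (-η) := by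
  obtain ⟨p, hp⟩ := exists_nat_gt η⁻¹
  have hp0 : (0 : ℝ) < p := (inv_pos.2 hη).trans hp
  obtain ⟨e, he, h⟩ := hs.2 p
  filter_upwards [eventually_lt_tailFilter Γ he] with z hz
  have hz0 : (0 : ℝ) < z.1 := z.1.2.1
  have h1 : (1 : ℝ) ≤ η * p := by
    rw [inv_lt_iff_one_lt_mul₀ hη] at hp
    linarith [mul_comm (p : ℝ) η]
  refine le_of_pow_le_pow_left₀ (n := p) (by exact_mod_cast hp0.ne') (by positivity) ?_
  refine (h z.1 hz).trans ?_
  rw [← Real.rpow_natCast, ← Real.rpow_mul hz0.le, ← Real.rpow_neg_one]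
  exact Real.rpow_le_rpow_of_exponent_ge hz0 z.1.2.2 (by linarith)

/-! ### Symbol classes with arbitrarily small loss in `ε` -/

/-- The weight `ε^{-q} (1 + |ξ|)^μ`. -/
def weight (q μ : ℝ) (z : Param × Eucl n) : ℝ := (z.1 : ℝ) ^ (-q) * (1 + ‖z.2‖) ^ μ

theorem weight_pos (q μ : ℝ) (z : Param × Eucl n) : 0 < weight q μ z :=
  mul_pos (Real.rpow_pos_of_pos z.1.2.1 _) (Real.rpow_pos_of_pos (by positivity) _)

theorem weight_mul (q μ q' μ' : ℝ) (z : Param × Eucl n) :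
    weight q μ z * weight q' μ' z = weight (q + q') (μ + μ') z := by
  unfold weight
  rw [neg_add, Real.rpow_add z.1.2.1, Real.rpow_add (by positivity)]
  ring

theorem weight_zero_right (q : ℝ) (z : Param × Eucl n) : weight q 0 z = (z.1 : ℝ) ^ (-q) := by
  simp [weight]

theorem weight_mono {q μ q' μ' : ℝ} (hq : q ≤ q') (hμ : μ ≤ μ') (z : Param × Eucl n) :
    weight q μ z ≤ weight q' μ' z :=
  mul_le_mul (Real.rpow_le_rpow_of_exponent_ge z.1.2.1 z.1.2.2 (by linarith))
    (Real.rpow_le_rpow_of_exponent_le (by linarith [norm_nonneg z.2]) hμ)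
    (by positivity) (Real.rpow_nonneg z.1.2.1.le _)

/-- On `V`, the functions `f_z` and their derivatives of order at most `k` satisfy the estimates
`|∂^α f_z| ≤ ε^{-q'} (1 + |ξ|)^{μ + δ|α|}`, `z = (ε, ξ)`, for all `q' > q`, in the sense of
`tailFilter Γ`. -/
def SymbolClass (Γ V : Set (Eucl n)) (δ : ℝ) : ℕ → ℝ → ℝ → (Param × Eucl n → Smooth n) → Prop
  | 0, q, μ, f => ∀ q' > q, ∀ᶠ z in tailFilter Γ, ∀ x ∈ V, ‖f z x‖ ≤ weight q' μ z
  | k + 1, q, μ, f => (∀ q' > q, ∀ᶠ z in tailFilter Γ, ∀ x ∈ V, ‖f z x‖ ≤ weight q' μ z) ∧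
      ∀ i, SymbolClass Γ V δ k q (μ + δ) fun z => Smooth.d i (f z)

namespace SymbolClass

variable {Γ V : Set (Eucl n)} {δ : ℝ} {k : ℕ} {q μ : ℝ} {f g : Param × Eucl n → Smooth n}

theorem bound (h : SymbolClass Γ V δ k q μ f) : ∀ q' > q, ∀ᶠ z in tailFilter Γ, ∀ x ∈ V,
    ‖f z x‖ ≤ weight q' μ z := by
  cases k with
  | zero => exact h
  | succ k => exact h.1

theorem of_succ (h : SymbolClass Γ V δ (k + 1) q μ f) : SymbolClass Γ V δ k q μ f := by
  induction k generalizing μ f with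
  | zero => exact h.1
  | succ k ih => exact ⟨h.1, fun i => ih (h.2 i)⟩

theorem mono (h : SymbolClass Γ V δ k q μ f) {q' μ' : ℝ} (hq : q ≤ q') (hμ : μ ≤ μ') :
    SymbolClass Γ V δ k q' μ' f := by
  have h0 : ∀ p > q', ∀ᶠ z in tailFilter Γ, ∀ x ∈ V, ‖f z x‖ ≤ weight p μ' z := fun p hp => by
    filter_upwards [h.bound p (by linarith)] with z hz x hx
    exact (hz x hx).trans (weight_mono le_rfl hμ z)
  induction k generalizing μ μ' f with
  | zero => exact h0
  | succ k ih =>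
    refine ⟨h0, fun i => ih (h.2 i) (by linarith) fun p hp => ?_⟩
    filter_upwards [(h.2 i).bound p (by linarith)] with z hz x hx
    exact (hz x hx).trans (weight_mono le_rfl (by linarith) z)

/-- Openness of `V` makes equality on `V` pass to derivatives; functions that are meaningful only on
`V`, such as reciprocals of the symbol, can thus be handled by any smooth extension. -/
theorem congr (hV : IsOpen V) (h : SymbolClass Γ V δ k q μ f)
    (hfg : ∀ᶠ z in tailFilter Γ, ∀ x ∈ V, g z x = f z x) : SymbolClass Γ V δ k q μ g := by
  have h0 : ∀ p > q, ∀ᶠ z in tailFilter Γ, ∀ x ∈ V, ‖g z x‖ ≤ weight p μ z := fun p hp => by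
    filter_upwards [h.bound p hp, hfg] with z hz hz' x hx
    rw [hz' x hx]; exact hz x hx
  induction k generalizing μ f g with
  | zero => exact h0
  | succ k ih =>
    have h1 : ∀ i, ∀ᶠ z in tailFilter Γ, ∀ x ∈ V, Smooth.d i (g z) x = Smooth.d i (f z) x :=
      fun i => hfg.mono fun z hz => Smooth.d_eqOn hV hz i
    refine ⟨h0, fun i => ih (h.2 i) (h1 i) fun p hp => ?_⟩
    filter_upwards [(h.2 i).bound p hp, h1 i] with z hz hz' x hx
    rw [hz' x hx]; exact hz x hx

/-- The room between `q` and `p` is split in two: one half is used for the summands, the other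
absorbs the constant `2`. -/
theorem add (hf : SymbolClass Γ V δ k q μ f) (hg : SymbolClass Γ V δ k q μ g) :
    SymbolClass Γ V δ k q μ fun z => f z + g z := by
  have h0 : ∀ {μ : ℝ} {f g : Param × Eucl n → Smooth n}, SymbolClass Γ V δ 0 q μ f →
      SymbolClass Γ V δ 0 q μ g → SymbolClass Γ V δ 0 q μ fun z => f z + g z := by
    intro μ f g hf hg p hp
    filter_upwards [hf ((p + q) / 2) (by linarith), hg ((p + q) / 2) (by linarith),
      eventually_const_le Γ 2 (η := (p - q) / 2) (by linarith)] with z h1 h2 h3 x hx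
    calc ‖f z x + g z x‖ ≤ weight ((p + q) / 2) μ z + weight ((p + q) / 2) μ z :=
          (norm_add_le _ _).trans (add_le_add (h1 x hx) (h2 x hx))
      _ = 2 * weight ((p + q) / 2) μ z := by ring
      _ ≤ weight ((p - q) / 2) 0 z * weight ((p + q) / 2) μ z := by
          rw [weight_zero_right]
          exact mul_le_mul_of_nonneg_right h3 (weight_pos _ _ _).le
      _ = weight p μ z := by rw [weight_mul]; congr 1 <;> ring
  induction k generalizing μ f g with
  | zero => exact h0 hf hg
  | succ k ih =>
    refine ⟨h0 hf.1 hg.1, fun i => ?_⟩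
    simpa only [map_add] using ih (hf.2 i) (hg.2 i)

theorem mul (hf : SymbolClass Γ V δ k q μ f) {q' μ' : ℝ} (hg : SymbolClass Γ V δ k q' μ' g) :
    SymbolClass Γ V δ k (q + q') (μ + μ') fun z => f z * g z := by
  have h0 : ∀ {μ μ' : ℝ} {f g : Param × Eucl n → Smooth n}, SymbolClass Γ V δ 0 q μ f →
      SymbolClass Γ V δ 0 q' μ' g → SymbolClass Γ V δ 0 (q + q') (μ + μ') fun z => f z * g z := by
    intro μ μ' f g hf hg p hp
    filter_upwards [hf (q + (p - (q + q')) / 2) (by linarith),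
      hg (q' + (p - (q + q')) / 2) (by linarith)] with z h1 h2 x hx
    rw [Smooth.mul_apply, norm_mul]
    refine (mul_le_mul (h1 x hx) (h2 x hx) (norm_nonneg _) (weight_pos _ _ _).le).trans_eq ?_
    rw [weight_mul]; congr 1; ring
  induction k generalizing μ μ' f g with
  | zero => exact h0 hf hg
  | succ k ih =>
    refine ⟨h0 hf.1 hg.1, fun i => ?_⟩
    simp only [Smooth.d_mul]
    have h1 := ih (hf.2 i) hg.of_succ
    have h2 := ih hf.of_succ (hg.2 i)
    rw [add_right_comm] at h1
    rw [← add_assoc] at h2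
    exact h1.add h2

theorem const_smul (hf : SymbolClass Γ V δ k q μ f) (c : ℂ) :
    SymbolClass Γ V δ k q μ fun z => c • f z := by
  have h0 : ∀ {μ : ℝ} {f : Param × Eucl n → Smooth n}, SymbolClass Γ V δ 0 q μ f →
      SymbolClass Γ V δ 0 q μ fun z => c • f z := by
    intro μ f hf p hp
    filter_upwards [hf ((p + q) / 2) (by linarith),
      eventually_const_le Γ ‖c‖ (η := (p - q) / 2) (by linarith)] with z h1 h3 x hx
    rw [Smooth.smul_apply, norm_mul]
    calc ‖c‖ * ‖f z x‖ ≤ weight ((p - q) / 2) 0 z * weight ((p + q) / 2) μ z := by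
          rw [weight_zero_right]
          exact mul_le_mul h3 (h1 x hx) (norm_nonneg _) (Real.rpow_nonneg z.1.2.1.le _)
      _ = weight p μ z := by rw [weight_mul]; congr 1 <;> ring
  induction k generalizing μ f with
  | zero => exact h0 hf
  | succ k ih =>
    refine ⟨h0 hf.1, fun i => ?_⟩
    simpa only [map_smul] using ih (hf.2 i)

theorem zero : SymbolClass Γ V δ k q μ fun _ => 0 := by
  have h0 : ∀ μ, SymbolClass Γ V δ 0 q μ fun _ => 0 := fun μ p _ =>
    Filter.Eventually.of_forall fun z x _ => by simpa using (weight_pos p μ z).le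
  induction k generalizing μ with
  | zero => exact h0 _
  | succ k ih =>
    refine ⟨h0 _, fun i => ?_⟩
    simpa only [map_zero] using ih

theorem sum {ι : Type*} (s : Finset ι) {f : ι → Param × Eucl n → Smooth n}
    (h : ∀ j ∈ s, SymbolClass Γ V δ k q μ (f j)) :
    SymbolClass Γ V δ k q μ fun z => ∑ j ∈ s, f j z := by
  induction s using Finset.cons_induction with
  | empty => simpa using zero
  | cons a s ha ih =>
    simp only [Finset.sum_cons]
    exact (h a (by simp)).add (ih fun j hj => h j (by simp [hj]))

theorem const (hδ : 0 ≤ δ) {K : Set (Eucl n)} (hK : IsCompact K) (hVK : V ⊆ K) (f : Smooth n) :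
    SymbolClass Γ V δ k 0 0 fun _ => f := by
  have h0 : ∀ f : Smooth n, SymbolClass Γ V δ 0 0 0 fun _ => f := by
    intro f p hp
    obtain ⟨C, hC⟩ := hK.exists_bound_of_continuousOn (Smooth.continuous f).continuousOn
    filter_upwards [eventually_const_le Γ C hp] with z hz x hx
    rw [weight_zero_right]
    exact (hC x (hVK hx)).trans hz
  induction k generalizing f with
  | zero => exact h0 f
  | succ k ih => exact ⟨h0 f, fun i => (ih (Smooth.d i f)).mono le_rfl (by linarith)⟩

/-- Each of the `|β|` derivatives raises the order by `δ` and uses up one order of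
differentiability, whence the hypothesis for all `k`. -/
theorem revPow_T (hf : ∀ k, SymbolClass Γ V δ k q μ f) (β : Fin n → ℕ) (k : ℕ) :
    SymbolClass Γ V δ k q (μ + δ * len β) fun z => revPow Smooth.T β (f z) := by
  have key : ∀ (l : List (Fin n)) (μ : ℝ) (f : Param × Eucl n → Smooth n),
      (∀ k, SymbolClass Γ V δ k q μ f) → ∀ k, SymbolClass Γ V δ k q (μ + δ * (l.map β).sum)
        fun z => (l.map fun i => Smooth.T i ^ β i).reverse.prod (f z) := by
    intro l
    induction l with
    | nil => intro μ f hf k; simpa using hf k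
    | cons i l ih =>
      intro μ f hf k
      simp only [List.map_cons, List.sum_cons, List.reverse_cons, List.prod_append,
        List.prod_singleton]
      rw [Nat.cast_add, mul_add, ← add_assoc]
      refine ih (μ + δ * β i) (fun z => (Smooth.T i ^ β i) (f z)) (fun k => ?_) k
      induction β i generalizing k with
      | zero => simpa using hf k
      | succ j hj =>
        have := ((hj (k + 1)).2 i).const_smul Complex.I
        rw [add_assoc, ← mul_add_one] at this
        rw [Nat.cast_succ]
        simp only [pow_succ']
        exact this
  have := key (List.finRange n) μ f hf k
  rwa [← List.ofFn_eq_map, ← List.ofFn_eq_map, List.sum_ofFn] at this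

theorem iterate_d (h : SymbolClass Γ V δ k q μ f) (i : Fin n) :
    ∀ q' > q, ∀ᶠ z in tailFilter Γ, ∀ x ∈ V,
      ‖((Smooth.d i)^[k] (f z) : Smooth n) x‖ ≤ weight q' (μ + δ * k) z := by
  induction k generalizing μ f with
  | zero => simpa using h.bound
  | succ k ih =>
    have := ih (h.2 i)
    rw [add_assoc, add_comm δ, ← mul_add_one] at this
    rw [Nat.cast_succ]
    exact this

end SymbolClass

/-! ### The parametrix -/


theorem multiPow_d_zero (f : Smooth n) : multiPow (fun i => Smooth.d i) 0 f = f := by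
  unfold multiPow
  induction List.finRange n with
  | nil => rfl
  | cons j l ih => exact ih

theorem multiPow_d_single (i : Fin n) (f : Smooth n) :
    multiPow (fun i => Smooth.d i) (Pi.single i 1) f = Smooth.d i f := by
  have h := apply_multiPow Smooth.d_comm 0 i f
  rw [zero_add, multiPow_d_zero] at h
  exact h.symm

theorem d_eq_of_mul_eq_one {V : Set (Eucl n)} (hV : IsOpen V) {p p' : Smooth n}
    (h : ∀ x ∈ V, p x * p' x = 1) (i : Fin n) :
    ∀ x ∈ V, Smooth.d i p' x = -(p' x * (Smooth.d i p x * p' x)) := by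
  intro x hx
  have h1 := Smooth.d_eqOn hV (F := p * p') (f := fun _ => 1) h i hx
  rw [Smooth.d_mul] at h1
  simp only [partialDeriv, fderiv_fun_const, Pi.zero_apply, Smooth.add_apply,
    Smooth.mul_apply] at h1
  simp only [zero_apply] at h1
  linear_combination p' x * h1 - Smooth.d i p' x * h x hx

section Parametrix

variable {Γ V : Set (Eucl n)} {δ ρ : ℝ} {m : ℕ} {a : Param → (Fin n → ℕ) → Smooth n}
  {p' : Param × Eucl n → Smooth n}

/-- The quotients `∂_x^α ∂_ξ^β p / p` are stable under differentiation: `∂ᵢ` of one equals the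
quotient for `α + eᵢ` minus its product with `∂ᵢp / p`, and both terms have order raised by exactly
`δ`. The hypothesis `hb` therefore yields all derivatives with no fixed loss in `ε`. -/
theorem symbolClass_quotient (hV : IsOpen V)
    (hp : ∀ᶠ z in tailFilter Γ, ∀ x ∈ V, smoothSymbol m (a z.1) 0 z.2 x * p' z x = 1)
    (hb : ∀ α β : Fin n → ℕ, len β ≤ m → ∀ η > 0, ∀ᶠ z in tailFilter Γ, ∀ x ∈ V,
      ‖(multiPow (fun i => Smooth.d i) α (smoothSymbol m (a z.1) β z.2) : Smooth n) x‖ ≤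
        weight η (δ * len α - ρ * len β) z * ‖smoothSymbol m (a z.1) 0 z.2 x‖)
    (α : Fin n → ℕ) {β : Fin n → ℕ} (hβ : len β ≤ m) (k : ℕ) :
    SymbolClass Γ V δ k 0 (δ * len α - ρ * len β)
      fun z => multiPow (fun i => Smooth.d i) α (smoothSymbol m (a z.1) β z.2) * p' z := by
  have h0 : ∀ α, ∀ β : Fin n → ℕ, len β ≤ m → SymbolClass Γ V δ 0 0 (δ * len α - ρ * len β)
      fun z => multiPow (fun i => Smooth.d i) α (smoothSymbol m (a z.1) β z.2) * p' z := by
    intro α β hβ η hη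
    filter_upwards [hp, hb α β hβ η hη] with z h1 h2 x hx
    rw [Smooth.mul_apply, norm_mul]
    refine (mul_le_mul_of_nonneg_right (h2 x hx) (norm_nonneg _)).trans_eq ?_
    rw [mul_assoc, ← norm_mul, h1 x hx, norm_one, mul_one]
  induction k generalizing α β with
  | zero => exact h0 α β hβ
  | succ k ih =>
    refine ⟨h0 α β hβ, fun i => ?_⟩
    have hlen : ∀ α : Fin n → ℕ, len (α + Pi.single i 1) = len α + 1 := by
      intro α
      simp [len, Finset.sum_add_distrib]
    have h1 := ih (α + Pi.single i 1) hβ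
    have h2 := (ih α hβ).mul (ih (Pi.single i 1) (β := 0) (by simp [len]))
    have e0 : len (Pi.single i 1 : Fin n → ℕ) = 1 := by simp [len]
    have e00 : len (0 : Fin n → ℕ) = 0 := by simp [len]
    rw [e0, e00] at h2
    rw [hlen] at h1
    have h3 := (h1.mono (q' := 0) (μ' := δ * len α - ρ * len β + δ) le_rfl
      (by push_cast; linarith)).add ((h2.const_smul (-1)).mono (by simp)
        (μ' := δ * len α - ρ * len β + δ) (by push_cast; linarith))
    refine h3.congr hV ?_
    filter_upwards [hp] with z hz x hx
    have e1 : ∀ f : Smooth n, multiPow (fun i => Smooth.d i) (α + Pi.single i 1) f =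
        Smooth.d i (multiPow (fun i => Smooth.d i) α f) := fun f =>
      (apply_multiPow Smooth.d_comm α i f).symm
    rw [Smooth.d_mul, e1, multiPow_d_single]
    simp only [Smooth.add_apply, Smooth.mul_apply, Smooth.smul_apply, d_eq_of_mul_eq_one hV hz i x hx]
    ring

/-- Since `∂ᵢp' = -p' (∂ᵢp · p')` and the bracket has `ε`-exponent `0`, the loss `ε^{-q}` of `p'`
does not grow under differentiation. -/
theorem symbolClass_inv (hV : IsOpen V)
    (hp : ∀ᶠ z in tailFilter Γ, ∀ x ∈ V, smoothSymbol m (a z.1) 0 z.2 x * p' z x = 1)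
    (hb : ∀ α β : Fin n → ℕ, len β ≤ m → ∀ η > 0, ∀ᶠ z in tailFilter Γ, ∀ x ∈ V,
      ‖(multiPow (fun i => Smooth.d i) α (smoothSymbol m (a z.1) β z.2) : Smooth n) x‖ ≤
        weight η (δ * len α - ρ * len β) z * ‖smoothSymbol m (a z.1) 0 z.2 x‖)
    {q μ : ℝ} (hq : ∀ᶠ z in tailFilter Γ, ∀ x ∈ V, ‖p' z x‖ ≤ weight q μ z) (k : ℕ) :
    SymbolClass Γ V δ k q μ p' := by
  have h0 : SymbolClass Γ V δ 0 q μ p' := fun q' hq' => by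
    filter_upwards [hq] with z hz x hx
    exact (hz x hx).trans (weight_mono hq'.le le_rfl z)
  induction k with
  | zero => exact h0
  | succ k ih =>
    refine ⟨h0, fun i => ?_⟩
    have h1 := symbolClass_quotient hV hp hb (Pi.single i 1) (β := 0) (by simp [len]) k
    refine (((ih.mul h1).const_smul (-1)).mono (by simp) (μ' := μ + δ) ?_).congr hV ?_
    · simp [len]
    · filter_upwards [hp] with z hz x hx
      rw [multiPow_d_single]
      simp only [Smooth.mul_apply, Smooth.smul_apply, d_eq_of_mul_eq_one hV hz i x hx]
      ring

/-- The operator `R`, `h ↦ h - e^{ixξ} ᵗP (e^{-ixξ} p' h)` if `p p' = 1`. -/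
def remainder (m : ℕ) (a : (Fin n → ℕ) → Smooth n) (ξ : Eucl n) (p' h : Smooth n) : Smooth n :=
  -∑ β ∈ (multiIndices n m).erase 0,
    (∏ i, ((β i).factorial : ℂ))⁻¹ • revPow Smooth.T β (smoothSymbol m a β ξ * p' * h)

/-- In the term of index `β`, the quotient contributes `-ρ|β|` and the `|β|` derivatives outside
contribute `δ|β|`. As `β ≠ 0`, the order drops by at least `ρ - δ`. -/
theorem symbolClass_remainder (hV : IsOpen V) (hδρ : δ < ρ)
    (hp : ∀ᶠ z in tailFilter Γ, ∀ x ∈ V, smoothSymbol m (a z.1) 0 z.2 x * p' z x = 1)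
    (hb : ∀ α β : Fin n → ℕ, len β ≤ m → ∀ η > 0, ∀ᶠ z in tailFilter Γ, ∀ x ∈ V,
      ‖(multiPow (fun i => Smooth.d i) α (smoothSymbol m (a z.1) β z.2) : Smooth n) x‖ ≤
        weight η (δ * len α - ρ * len β) z * ‖smoothSymbol m (a z.1) 0 z.2 x‖)
    {μ : ℝ} {f : Param × Eucl n → Smooth n} (hf : ∀ k, SymbolClass Γ V δ k 0 μ f) (k : ℕ) :
    SymbolClass Γ V δ k 0 (μ - (ρ - δ)) fun z => remainder m (a z.1) z.2 (p' z) (f z) := by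
  have key := (SymbolClass.sum (Γ := Γ) (V := V) (δ := δ) (k := k) (q := 0) (μ := μ - (ρ - δ))
    ((multiIndices n m).erase 0) (f := fun β z => (∏ i, ((β i).factorial : ℂ))⁻¹ •
      revPow Smooth.T β (smoothSymbol m (a z.1) β z.2 * p' z * f z)) fun β hβ => by
    rw [Finset.mem_erase] at hβ
    have h1 : (1 : ℝ) ≤ len β := by
      have : len β ≠ 0 := fun h => hβ.1 (funext fun i => by
        simpa using (Finset.sum_eq_zero_iff.1 h) i (Finset.mem_univ i))
      exact_mod_cast Nat.one_le_iff_ne_zero.2 this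
    refine SymbolClass.const_smul ?_ _
    have h2 := fun k => (symbolClass_quotient hV hp hb 0 (mem_multiIndices.1 hβ.2) k).mul (hf k)
    refine (SymbolClass.revPow_T (μ := μ - ρ * len β) (f := fun z => smoothSymbol m (a z.1) β z.2 * p' z * f z)
      (fun k => ?_) β k).mono le_rfl ?_
    · have h3 := h2 k
      have e0 : ∀ f : Smooth n, multiPow (fun i => Smooth.d i) 0 f = f := multiPow_d_zero
      simp only [e0] at h3
      exact h3.mono (by simp) (by simp [len])
    · nlinarith).const_smul (-1)
  simp only [neg_one_smul] at key
  exact key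

theorem transposed_mul {F : Set (Eucl n)} (m : ℕ) (a : (Fin n → ℕ) → Smooth n) (ξ : Eucl n)
    {p' h : Smooth n} (hp : ∀ x ∈ F, smoothSymbol m a 0 ξ x * p' x = 1) (hh : ∀ x ∉ F, h x = 0) :
    transposed m a ξ (p' * h) = h - remainder m a ξ p' h := by
  have h0 : (0 : Fin n → ℕ) ∈ multiIndices n m := mem_multiIndices.2 (by simp [len])
  have h1 : revPow Smooth.T (0 : Fin n → ℕ) (smoothSymbol m a 0 ξ * (p' * h)) = h := by
    have : revPow Smooth.T (0 : Fin n → ℕ) = 1 := by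
      simp [revPow]
    rw [this]
    ext x
    change smoothSymbol m a 0 ξ x * (p' x * h x) = h x
    by_cases hx : x ∈ F
    · rw [← mul_assoc, hp x hx, one_mul]
    · rw [hh x hx]; simp
  rw [transposed, ← Finset.add_sum_erase _ _ h0, h1, remainder, sub_neg_eq_add]
  simp [mul_assoc]

theorem remainder_eq_zero {F : Set (Eucl n)} (hF : IsClosed F) (m : ℕ)
    (a : (Fin n → ℕ) → Smooth n) (ξ : Eucl n) (p' : Smooth n) {h : Smooth n}
    (hh : ∀ x ∉ F, h x = 0) : ∀ x ∉ F, remainder m a ξ p' h x = 0 := by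
  intro x hx
  simp only [remainder, Smooth.neg_apply, Smooth.sum_apply, Smooth.smul_apply]
  rw [Finset.sum_eq_zero, neg_zero]
  intro β _
  rw [revPow_eq_zero hF.isOpen_compl β (fun y hy => by simp [hh y hy]) x hx, mul_zero]

/-- The sum `ψ + Rψ + ⋯ + R^{N-1}ψ`. -/
def neumannSum (m : ℕ) (a : (Fin n → ℕ) → Smooth n) (ξ : Eucl n) (p' ψ : Smooth n) (N : ℕ) :
    Smooth n :=
  ∑ k ∈ Finset.range N, (remainder m a ξ p')^[k] ψ

theorem iterate_remainder_eq_zero {F : Set (Eucl n)} (hF : IsClosed F) (m : ℕ)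
    (a : (Fin n → ℕ) → Smooth n) (ξ : Eucl n) (p' : Smooth n) {h : Smooth n}
    (hh : ∀ x ∉ F, h x = 0) (k : ℕ) : ∀ x ∉ F, ((remainder m a ξ p')^[k] h : Smooth n) x = 0 := by
  induction k with
  | zero => exact hh
  | succ k ih =>
    rw [Function.iterate_succ_apply']
    exact remainder_eq_zero hF m a ξ p' ih

theorem transposed_add (m : ℕ) (a : (Fin n → ℕ) → Smooth n) (ξ : Eucl n) (f g : Smooth n) :
    transposed m a ξ (f + g) = transposed m a ξ f + transposed m a ξ g := by
  simp [transposed, mul_add, Finset.sum_add_distrib]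

/-- The sum telescopes, since by `transposed_mul` each summand `R^k ψ` contributes `R^k ψ - R^{k+1}
ψ`. -/
theorem transposed_neumannSum {F : Set (Eucl n)} (hF : IsClosed F) (m : ℕ)
    (a : (Fin n → ℕ) → Smooth n) (ξ : Eucl n) {p' ψ : Smooth n}
    (hp : ∀ x ∈ F, smoothSymbol m a 0 ξ x * p' x = 1) (hψ : ∀ x ∉ F, ψ x = 0) (N : ℕ) :
    transposed m a ξ (p' * neumannSum m a ξ p' ψ N) = ψ - (remainder m a ξ p')^[N] ψ := by
  induction N with
  | zero => simp [neumannSum, transposed]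
  | succ N ih =>
    rw [neumannSum, Finset.sum_range_succ, mul_add, transposed_add, ← neumannSum, ih,
      transposed_mul m a ξ hp (iterate_remainder_eq_zero hF m a ξ p' hψ N),
      Function.iterate_succ_apply']
    abel

theorem neumannSum_eq_zero {F : Set (Eucl n)} (hF : IsClosed F) (m : ℕ)
    (a : (Fin n → ℕ) → Smooth n) (ξ : Eucl n) (p' : Smooth n) {ψ : Smooth n}
    (hψ : ∀ x ∉ F, ψ x = 0) (N : ℕ) : ∀ x ∉ F, neumannSum m a ξ p' ψ N x = 0 := by
  intro x hx
  rw [neumannSum, Smooth.sum_apply]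
  exact Finset.sum_eq_zero fun k _ => iterate_remainder_eq_zero hF m a ξ p' hψ k x hx

theorem symbolClass_iterate_remainder (hV : IsOpen V) (hδ : 0 ≤ δ) (hδρ : δ < ρ)
    (hp : ∀ᶠ z in tailFilter Γ, ∀ x ∈ V, smoothSymbol m (a z.1) 0 z.2 x * p' z x = 1)
    (hb : ∀ α β : Fin n → ℕ, len β ≤ m → ∀ η > 0, ∀ᶠ z in tailFilter Γ, ∀ x ∈ V,
      ‖(multiPow (fun i => Smooth.d i) α (smoothSymbol m (a z.1) β z.2) : Smooth n) x‖ ≤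
        weight η (δ * len α - ρ * len β) z * ‖smoothSymbol m (a z.1) 0 z.2 x‖)
    {K : Set (Eucl n)} (hK : IsCompact K) (hVK : V ⊆ K) (ψ : Smooth n) (N k : ℕ) :
    SymbolClass Γ V δ k 0 (-(N * (ρ - δ)))
      fun z => (remainder m (a z.1) z.2 (p' z))^[N] ψ := by
  induction N generalizing k with
  | zero => simpa using SymbolClass.const hδ hK hVK ψ
  | succ N ih =>
    have := symbolClass_remainder hV hδρ hp hb ih k
    simp only [Function.iterate_succ_apply']
    exact this.mono le_rfl (by push_cast; linarith)

theorem symbolClass_neumannSum (hV : IsOpen V) (hδ : 0 ≤ δ) (hδρ : δ < ρ)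
    (hp : ∀ᶠ z in tailFilter Γ, ∀ x ∈ V, smoothSymbol m (a z.1) 0 z.2 x * p' z x = 1)
    (hb : ∀ α β : Fin n → ℕ, len β ≤ m → ∀ η > 0, ∀ᶠ z in tailFilter Γ, ∀ x ∈ V,
      ‖(multiPow (fun i => Smooth.d i) α (smoothSymbol m (a z.1) β z.2) : Smooth n) x‖ ≤
        weight η (δ * len α - ρ * len β) z * ‖smoothSymbol m (a z.1) 0 z.2 x‖)
    {K : Set (Eucl n)} (hK : IsCompact K) (hVK : V ⊆ K) (ψ : Smooth n) (N k : ℕ) :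
    SymbolClass Γ V δ k 0 0 fun z => neumannSum m (a z.1) z.2 (p' z) ψ N :=
  SymbolClass.sum _ fun j _ =>
    (symbolClass_iterate_remainder hV hδ hδρ hp hb hK hVK ψ j k).mono le_rfl (by
      have : 0 ≤ (j : ℝ) * (ρ - δ) := mul_nonneg (Nat.cast_nonneg _) (by linarith)
      linarith)

end Parametrix

/-! ### Fourier transforms of smooth functions with compact support -/

/-- The Fourier transform `∫ f(x) e^{-iξx} dx`. -/
def fourier (f : Smooth n) (ξ : Eucl n) : ℂ := ∫ x, f x * expo ξ x

theorem fourier_d {F : Set (Eucl n)} (hF : IsCompact F) {g : Smooth n} (hg : ∀ x ∉ F, g x = 0)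
    (i : Fin n) (ξ : Eucl n) : fourier (Smooth.d i g) ξ = Complex.I * (ξ i : ℂ) * fourier g ξ := by
  have h := integral_d_mul hF (expo ξ) g hg i
  unfold fourier
  rw [← MeasureTheory.integral_const_mul]
  calc ∫ x, Smooth.d i g x * expo ξ x = ∫ x, expo ξ x * Smooth.d i g x := by
        simp_rw [mul_comm]
    _ = -∫ x, Smooth.d i (expo ξ) x * g x := by rw [h, neg_neg]
    _ = ∫ x, Complex.I * (ξ i : ℂ) * (g x * expo ξ x) := by
        rw [← MeasureTheory.integral_neg]
        congr 1; ext x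
        rw [d_expo]
        simp
        ring

theorem fourier_iterate_d {F : Set (Eucl n)} (hF : IsCompact F) {g : Smooth n}
    (hg : ∀ x ∉ F, g x = 0) (i : Fin n) (k : ℕ) (ξ : Eucl n) :
    (∀ x ∉ F, ((Smooth.d i)^[k] g : Smooth n) x = 0) ∧
      fourier ((Smooth.d i)^[k] g) ξ = (Complex.I * (ξ i : ℂ)) ^ k * fourier g ξ := by
  induction k with
  | zero => simpa using hg
  | succ k ih =>
    rw [Function.iterate_succ_apply']
    refine ⟨Smooth.d_eq_zero hF.isClosed.isOpen_compl ih.1 i, ?_⟩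
    rw [fourier_d hF ih.1, ih.2]
    ring

theorem norm_fourier_le {F : Set (Eucl n)} (hF : IsCompact F) {g : Smooth n}
    (hg : ∀ x ∉ F, g x = 0) {B : ℝ} (hB : ∀ x ∈ F, ‖g x‖ ≤ B) (ξ : Eucl n) :
    ‖fourier g ξ‖ ≤ MeasureTheory.volume.real F * B := by
  unfold fourier
  rw [← MeasureTheory.setIntegral_eq_integral_of_forall_compl_eq_zero (s := F)
    (fun x hx => by rw [hg x hx, zero_mul]), mul_comm]
  refine MeasureTheory.norm_setIntegral_le_of_norm_le_const hF.measure_lt_top fun x hx => ?_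
  rw [norm_mul, norm_expo, mul_one]
  exact hB x hx

theorem exists_norm_le_card_mul (η : Eucl n) (hη : 0 < ‖η‖) : ∃ j, ‖η‖ ≤ n * |η j| := by
  by_contra! h
  have h1 : ‖η‖ ≤ ∑ j, |η j| := by
    have : η = ∑ j, EuclideanSpace.single j (η j) := by
      ext i; simp [Finset.sum_apply, Pi.single_apply]
    calc ‖η‖ = ‖∑ j, EuclideanSpace.single j (η j)‖ := by rw [← this]
      _ ≤ ∑ j, ‖EuclideanSpace.single j (η j)‖ := norm_sum_le _ _
      _ = ∑ j, |η j| := by simp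
  rcases Nat.eq_zero_or_pos n with rfl | hn
  · simp only [Finset.univ_eq_empty, Finset.sum_empty] at h1; linarith
  · have : Nonempty (Fin n) := ⟨⟨0, hn⟩⟩
    have h2 : ∑ j : Fin n, (n : ℝ) * |η j| < ∑ _j : Fin n, ‖η‖ :=
      Finset.sum_lt_sum_of_nonempty Finset.univ_nonempty fun j _ => h j
    rw [← Finset.mul_sum] at h2
    simp at h2
    have hn' : (0 : ℝ) < n := by exact_mod_cast hn
    have := lt_of_mul_lt_mul_left h2 hn'.le
    linarith

/-- For `|η| > 1` some coordinate satisfies `|η| ≤ n |η_j|`, and `k` derivatives in that direction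
produce the factor `|η_j|^k`. For `|η| ≤ 1` the trivial bound is enough. -/
theorem norm_fourier_mul_le {F : Set (Eucl n)} (hF : IsCompact F) {g : Smooth n}
    (hg : ∀ x ∉ F, g x = 0) {B : ℝ} (k : ℕ) (hB : ∀ x ∈ F, ‖g x‖ ≤ B)
    (hBk : ∀ j, ∀ x ∈ F, ‖((Smooth.d j)^[k] g : Smooth n) x‖ ≤ B) (η : Eucl n) :
    ‖fourier g η‖ * (1 + ‖η‖) ^ k ≤ (2 * (n + 1)) ^ k * (MeasureTheory.volume.real F * B) := by
  have h0 := norm_fourier_le hF hg hB η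
  rcases le_or_gt ‖η‖ 1 with h1 | h1
  · rw [mul_comm]
    refine mul_le_mul (pow_le_pow_left₀ (by positivity) ?_ k) h0 (norm_nonneg _) (by positivity)
    have : (0 : ℝ) ≤ n := Nat.cast_nonneg n
    linarith
  · obtain ⟨j, hj⟩ := exists_norm_le_card_mul η (by linarith)
    have h2 := norm_fourier_le hF (fourier_iterate_d hF hg j k η).1 (hBk j) η
    rw [(fourier_iterate_d hF hg j k η).2, norm_mul, norm_pow, norm_mul, Complex.norm_I, one_mul,
      Complex.norm_real, Real.norm_eq_abs] at h2
    have h3 : (1 + ‖η‖) ^ k ≤ (2 * (n + 1)) ^ k * |η j| ^ k := by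
      rw [← mul_pow]
      refine pow_le_pow_left₀ (by positivity) ?_ k
      nlinarith [abs_nonneg (η j)]
    calc ‖fourier g η‖ * (1 + ‖η‖) ^ k ≤ ‖fourier g η‖ * ((2 * (n + 1)) ^ k * |η j| ^ k) :=
          mul_le_mul_of_nonneg_left h3 (norm_nonneg _)
      _ = (2 * (n + 1)) ^ k * (|η j| ^ k * ‖fourier g η‖) := by ring
      _ ≤ _ := mul_le_mul_of_nonneg_left h2 (by positivity)

-- The multiplication formula `∫ 𝓕a · b = ∫ a · 𝓕b` with `a = f e^{-iξx}` and `b = 𝓕⁻ g`. The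
-- factors `2π` convert between the normalisation of `𝓕` and that of `fourier`.
open FourierTransform in
theorem integral_mul_expo_mul {F F' : Set (Eucl n)} (hF : IsCompact F) (hF' : IsCompact F')
    {f g : Smooth n} (hf : ∀ x ∉ F, f x = 0) (hg : ∀ x ∉ F', g x = 0) (ξ : Eucl n) :
    ∫ x, f x * (expo ξ x * g x) = ∫ ζ, fourier f (ξ + (2 * Real.pi) • ζ) *
      fourier g (-((2 * Real.pi) • ζ)) := by
  let f' : SchwartzMap (Eucl n) ℂ := HasCompactSupport.toSchwartzMap (f := (f * expo ξ : Smooth n))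
    (HasCompactSupport.intro hF fun x hx => by simp [hf x hx]) (Smooth.contDiff _)
  let g' : SchwartzMap (Eucl n) ℂ := HasCompactSupport.toSchwartzMap (f := g)
    (HasCompactSupport.intro hF' hg) (Smooth.contDiff _)
  have h := SchwartzMap.integral_fourier_mul_eq f' (𝓕⁻ g')
  rw [FourierTransform.fourier_fourierInv_eq] at h
  have h1 : ∀ ζ, 𝓕 f' ζ = fourier f (ξ + (2 * Real.pi) • ζ) := by
    intro ζ
    rw [SchwartzMap.fourier_coe, Real.fourier_eq', fourier]
    congr 1; ext x
    change Complex.exp _ * (f x * expo ξ x) = _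
    rw [expo_apply, expo_apply, mul_left_comm, ← Complex.exp_add]
    congr 2
    rw [inner_add_left, inner_smul_left, real_inner_comm]
    push_cast
    simp
    ring
  have h2 : ∀ ζ, 𝓕⁻ g' ζ = fourier g (-((2 * Real.pi) • ζ)) := by
    intro ζ
    rw [SchwartzMap.fourierInv_coe, Real.fourierInv_eq', fourier]
    congr 1; ext x
    change Complex.exp _ * g x = _
    rw [expo_apply, mul_comm]
    congr 2
    rw [inner_neg_left, inner_smul_left, real_inner_comm]
    push_cast
    simp
    ring
  simp_rw [h1, h2] at h
  rw [h]
  congr 1; ext x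
  change _ = (f x * expo ξ x) * g x
  ring

theorem zpow_mul_zpow_eq_weight (M l : ℕ) (ε : Param) (ξ : Eucl n) :
    (ε : ℝ) ^ (-(M : ℤ)) * (1 + ‖ξ‖) ^ (-(l : ℤ)) = weight M (-l) (ε, ξ) := by
  unfold weight
  rw [← Real.rpow_intCast, ← Real.rpow_intCast]
  push_cast
  rfl

/-- The microlocal estimate of the Fourier transform of a product. -/
theorem integral_mul_expo_mul_le {Γ Γ' V F F' : Set (Eucl n)} (hF : IsCompact F)
    (hF' : IsCompact F') (hFV : F' ⊆ V) {c : ℝ} (hc : 0 < c) (hc2 : c ≤ 1 / 2)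
    (hΓ : ∀ ξ ∈ Γ, ∀ η : Eucl n, ‖η‖ ≤ c * ‖ξ‖ → ξ + η ∈ Γ')
    {f : Param → Smooth n} (hf : ∀ ε, ∀ x ∉ F, f ε x = 0)
    {M : ℝ} {C₀ : ℝ} (hC₀ : 0 ≤ C₀) (hf0 : ∃ ε₀ > 0, ∀ ε : Param, (ε : ℝ) < ε₀ → ∀ ξ,
      ‖fourier (f ε) ξ‖ ≤ C₀ * weight M 0 (ε, ξ))
    (hfl : ∀ l : ℕ, ∃ C : ℝ, 0 ≤ C ∧ ∃ ε₀ > 0, ∀ ε : Param, (ε : ℝ) < ε₀ → ∀ ξ ∈ Γ',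
      ‖fourier (f ε) ξ‖ ≤ C * weight M (-l) (ε, ξ))
    {δ : ℝ} (hδ : 0 ≤ δ) (hδ1 : δ < 1) {q μ : ℝ} {g : Param × Eucl n → Smooth n}
    (hg : ∀ z, ∀ x ∉ F', g z x = 0) (hgs : ∀ k, SymbolClass Γ V δ k q μ g) (l : ℕ) :
    ∃ C : ℝ, 0 ≤ C ∧ ∀ᶠ z in tailFilter Γ,
      ‖∫ x, f z.1 x * (expo z.2 x * g z x)‖ ≤ C * weight (M + (q + 1)) (-l) z := by
  -- Far from `ξ`, the `k = n + 1 + k₂` derivatives of `g` cost `δk` and yield a decay of order `k₂`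
  -- in `ξ`; the remaining `n + 1` make the integral converge. The choice ensures `|μ| + δk - k₂ ≤
  -- -l`, which is possible because `δ < 1`.
  obtain ⟨k₂, hk₂⟩ := exists_nat_ge ((l + |μ| + δ * (n + 1)) / (1 - δ))
  rw [div_le_iff₀ (by linarith)] at hk₂
  set k : ℕ := n + 1 + k₂ with hk
  -- Near `ξ`, the decay of `f` has to compensate the growth `|μ| + δk` of the bound on `g` as well.
  obtain ⟨l', hl'⟩ := exists_nat_ge (l + |μ| + δ * k)
  obtain ⟨C₁, hC₁, ε₁, hε₁, h1⟩ := hfl l'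
  obtain ⟨ε₀, hε₀, h0⟩ := hf0
  set Ck : ℝ := (2 * (n + 1)) ^ k * MeasureTheory.volume.real F' with hCk
  have hCk0 : 0 ≤ Ck := by positivity
  have hB1 : ∀ᶠ z in tailFilter Γ, ∀ x ∈ V, ‖g z x‖ ≤ weight (q + 1) (|μ| + δ * k) z := by
    filter_upwards [(hgs 0).bound (q + 1) (by linarith)] with z hz x hx
    refine (hz x hx).trans (weight_mono le_rfl ?_ z)
    have : 0 ≤ δ * k := by positivity
    linarith [le_abs_self μ]
  have hB2 : ∀ᶠ z in tailFilter Γ, ∀ j, ∀ x ∈ V,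
      ‖((Smooth.d j)^[k] (g z) : Smooth n) x‖ ≤ weight (q + 1) (|μ| + δ * k) z := by
    rw [Filter.eventually_all]
    intro j
    filter_upwards [(hgs k).iterate_d j (q + 1) (by linarith)] with z hz x hx
    refine (hz x hx).trans (weight_mono le_rfl ?_ z)
    linarith [le_abs_self μ]
  refine ⟨(C₁ * 2 ^ l' + C₀ * c⁻¹ ^ k₂) * Ck *
    ∫ ζ : Eucl n, (1 + ‖ζ‖) ^ (-((n + 1 : ℕ) : ℝ)), mul_nonneg (by positivity)
      (MeasureTheory.integral_nonneg fun ζ => by positivity), ?_⟩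
  filter_upwards [hB1, hB2, eventually_lt_tailFilter Γ hε₀, eventually_lt_tailFilter Γ hε₁,
    eventually_mem_tailFilter Γ] with z hz1 hz2 hz3 hz4 hz5
  have hpt : ∀ η : Eucl n, ‖fourier (f z.1) (z.2 + η)‖ * ‖fourier (g z) (-η)‖ ≤
      (C₁ * 2 ^ l' + C₀ * c⁻¹ ^ k₂) * Ck * weight (M + (q + 1)) (-l) z *
        (1 + ‖η‖) ^ (-((n + 1 : ℕ) : ℝ)) := by
    intro η
    have hY : (0 : ℝ) < 1 + ‖η‖ := by positivity
    have hX : (0 : ℝ) < 1 + ‖z.2‖ := by positivity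
    have hb := norm_fourier_mul_le hF' (hg z) k (fun x hx => hz1 x (hFV hx))
      (fun j x hx => hz2 j x (hFV hx)) (-η)
    rw [norm_neg, ← mul_assoc, ← hCk] at hb
    set b := ‖fourier (g z) (-η)‖
    set B := weight (q + 1) (|μ| + δ * k) z with hB
    have hB0 : 0 < B := weight_pos _ _ _
    have hb' : b ≤ Ck * B * ((1 + ‖η‖) ^ k₂)⁻¹ * (1 + ‖η‖) ^ (-((n + 1 : ℕ) : ℝ)) := by
      rw [Real.rpow_neg hY.le, Real.rpow_natCast, mul_assoc, ← mul_inv, ← pow_add,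
        add_comm k₂, ← hk, ← div_eq_mul_inv, le_div_iff₀ (by positivity)]
      exact hb
    set Y := (1 + ‖η‖) ^ (-((n + 1 : ℕ) : ℝ)) with hYdef
    have hY0 : 0 < Y := Real.rpow_pos_of_pos hY _
    have hw := weight_pos (M + (q + 1)) (-l) z
    -- For `|η| ≤ c|ξ|` the point `ξ + η` lies in `Γ'` and `1 + |ξ + η| ≥ (1 + |ξ|)/2`, so the decay
    -- of `f` applies. Otherwise `1 + |η| ≥ c(1 + |ξ|)`, and the decay of `g` in `η` becomes decay
    -- in `ξ`.
    rcases le_or_gt ‖η‖ (c * ‖z.2‖) with hη | hη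
    · have ha := h1 z.1 hz4 (z.2 + η) (hΓ z.2 hz5 η hη)
      have ha' : weight M (-l') (z.1, z.2 + η) ≤ 2 ^ l' * weight M (-l') z := by
        unfold weight
        rw [mul_left_comm]
        refine mul_le_mul_of_nonneg_left ?_ (Real.rpow_nonneg z.1.2.1.le _)
        have h3 : (1 + ‖z.2‖) / 2 ≤ 1 + ‖z.2 + η‖ := by
          have := norm_sub_le (z.2 + η) η
          rw [add_sub_cancel_right] at this
          nlinarith [norm_nonneg z.2]
        refine (Real.rpow_le_rpow_of_nonpos (by positivity) h3 (by simp)).trans_eq ?_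
        rw [Real.rpow_neg (by positivity), Real.rpow_neg (by positivity), Real.rpow_natCast,
          Real.rpow_natCast, div_pow, inv_div, div_eq_mul_inv]
      have hb2 : b ≤ Ck * B * Y := by
        refine hb'.trans ?_
        refine mul_le_mul_of_nonneg_right ?_ hY0.le
        exact mul_le_of_le_one_right (by positivity)
          (inv_le_one_of_one_le₀ (one_le_pow₀ (by linarith [norm_nonneg η])))
      calc _ ≤ (C₁ * (2 ^ l' * weight M (-l') z)) * (Ck * B * Y) :=
            mul_le_mul (ha.trans (mul_le_mul_of_nonneg_left ha' hC₁)) hb2 (norm_nonneg _)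
              (by have := weight_pos M (-l') z; positivity)
        _ = C₁ * 2 ^ l' * Ck * weight (M + (q + 1)) (-l' + (|μ| + δ * k)) z * Y := by
            rw [← weight_mul]; ring
        _ ≤ C₁ * 2 ^ l' * Ck * weight (M + (q + 1)) (-l) z * Y := by
            gcongr
            exact weight_mono le_rfl (by linarith) z
        _ ≤ _ := by
            gcongr
            exact le_add_of_nonneg_right (by positivity)
    · have ha := h0 z.1 hz3 (z.2 + η)
      have ha' : weight M 0 (z.1, z.2 + η) = weight M 0 z := by
        rw [weight_zero_right, weight_zero_right]
      rw [ha'] at ha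
      have hb2 : ((1 + ‖η‖) ^ k₂)⁻¹ ≤ c⁻¹ ^ k₂ * weight 0 (-k₂) z := by
        have h3 : c * (1 + ‖z.2‖) ≤ 1 + ‖η‖ := by linarith
        have h4 : weight 0 (-k₂) z = ((1 + ‖z.2‖) ^ k₂)⁻¹ := by
          rw [weight, neg_zero, Real.rpow_zero, one_mul, Real.rpow_neg hX.le, Real.rpow_natCast]
        rw [h4, inv_pow, ← mul_inv, ← mul_pow]
        exact inv_anti₀ (by positivity) (pow_le_pow_left₀ (by positivity) h3 _)
      have hexp : |μ| + δ * k + -k₂ ≤ -(l : ℝ) := by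
        rw [hk]; push_cast; nlinarith
      calc _ ≤ (C₀ * weight M 0 z) * (Ck * B * (c⁻¹ ^ k₂ * weight 0 (-k₂) z) * Y) := by
            refine mul_le_mul ha (hb'.trans ?_) (norm_nonneg _)
              (by have := weight_pos M 0 z; positivity)
            gcongr
        _ = C₀ * c⁻¹ ^ k₂ * Ck * weight (M + (q + 1 + 0)) (0 + (|μ| + δ * k + -k₂)) z * Y := by
            rw [← weight_mul M, ← weight_mul (q + 1)]; ring
        _ ≤ C₀ * c⁻¹ ^ k₂ * Ck * weight (M + (q + 1)) (-l) z * Y := by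
            gcongr
            exact weight_mono (by linarith) (by linarith) z
        _ ≤ _ := by
            gcongr
            exact le_add_of_nonneg_left (by positivity)
  rw [integral_mul_expo_mul hF hF' (hf z.1) (hg z)]
  have hint : MeasureTheory.Integrable fun ζ : Eucl n => (1 + ‖ζ‖) ^ (-((n + 1 : ℕ) : ℝ)) :=
    integrable_one_add_norm (by simp)
  refine (MeasureTheory.norm_integral_le_of_norm_le (hint.const_mul
    ((C₁ * 2 ^ l' + C₀ * c⁻¹ ^ k₂) * Ck * weight (M + (q + 1)) (-l) z))
    (Filter.Eventually.of_forall fun ζ => ?_)).trans_eq ?_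
  · rw [norm_mul]
    refine (hpt _).trans ?_
    have hw := weight_pos (M + (q + 1)) (-l) z
    refine mul_le_mul_of_nonneg_left ?_ (by positivity)
    refine Real.rpow_le_rpow_of_nonpos (by positivity) ?_ (by
      have : (0 : ℝ) ≤ ((n + 1 : ℕ) : ℝ) := Nat.cast_nonneg _
      linarith)
    rw [norm_smul, Real.norm_eq_abs, abs_of_pos (by positivity)]
    nlinarith [norm_nonneg ζ, Real.pi_gt_three]
  · rw [MeasureTheory.integral_const_mul]
    ring

theorem cutoffFourier_eq {Ω : TopologicalSpace.Opens (Eucl n)} (φ : 𝓓(Ω, ℂ)) (u : Moderate Ω)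
    (ε : Param) (ξ : Eucl n) : cutoffFourier φ u ε ξ = fourier (cutoff φ (u.2.1 ε)) ξ := rfl

theorem cutoff_eq_zero {Ω : TopologicalSpace.Opens (Eucl n)} (φ : 𝓓(Ω, ℂ)) {f : Eucl n → ℂ}
    (hf : ContDiffOn ℝ ∞ f Ω) : ∀ x ∉ tsupport φ, cutoff φ hf x = 0 := fun x hx => by
  rw [cutoff_apply, image_eq_zero_of_notMem_tsupport hx, zero_mul]

/-! ### Representatives and rapid decrease -/

/-- Nets that are rapidly decreasing for large `ξ` and moderate for small `ξ` are rapidly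
decreasing. -/
theorem rapidlyDecreasing_of_tailFilter {Γ : Set (Eucl n)} {g : Param → Eucl n → ℂ} {C₀ M₀ M : ℝ}
    (hC₀ : 0 ≤ C₀) (h0 : ∃ ε₀ > 0, ∀ ε : Param, (ε : ℝ) < ε₀ → ∀ ξ,
      ‖g ε ξ‖ ≤ C₀ * weight M₀ 0 (ε, ξ))
    (h : ∀ l : ℕ, ∃ C : ℝ, ∀ᶠ z in tailFilter Γ, ‖g z.1 z.2‖ ≤ C * weight M (-l) z) :
    RapidlyDecreasing Γ g := by
  -- The extra `1` pays for `|ξ| < r_ε`: there `(1 + |ξ|)^l ≤ 2^l max(r_ε, 1)^l ≤ 2^l / ε` for small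
  -- `ε`. Thanks to slow scale the cost is one factor `1/ε` for every `l`.
  obtain ⟨N, hN⟩ := exists_nat_ge (max M (M₀ + 1))
  have hN1 : M ≤ N := (le_max_left _ _).trans hN
  have hN2 : M₀ + 1 ≤ N := (le_max_right _ _).trans hN
  obtain ⟨e₀, he₀, h0⟩ := h0
  refine ⟨N, fun l => ?_⟩
  obtain ⟨C, hC⟩ := h l
  obtain ⟨r, hr, e₁, he₁, h1⟩ := eventually_tailFilter.1 hC
  obtain ⟨e₂, he₂, h2⟩ := (hr.max slowScale_one).2 l
  refine ⟨|C| + C₀ * 2 ^ l + 1, by positivity, min (min e₀ e₁) (min e₂ (1 / 2)), by positivity,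
    ((min_le_right _ _).trans (min_le_right _ _)).trans_lt (by norm_num), fun ξ hξ ε hε => ?_⟩
  obtain ⟨⟨hε0, hε1⟩, hε2, -⟩ : ((ε : ℝ) < e₀ ∧ (ε : ℝ) < e₁) ∧ (ε : ℝ) < e₂ ∧ (ε : ℝ) < 1 / 2 := by
    simpa [lt_min_iff] using hε
  rw [mul_assoc, zpow_mul_zpow_eq_weight]
  have hw := weight_pos N (-l) (ε, ξ)
  rcases le_or_gt (r ε) ‖ξ‖ with hrξ | hrξ
  · calc ‖g ε ξ‖ ≤ C * weight M (-l) (ε, ξ) := h1 ε ξ hε1 hξ hrξ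
      _ ≤ |C| * weight N (-l) (ε, ξ) :=
          mul_le_mul (le_abs_self C) (weight_mono hN1 le_rfl _) (weight_pos _ _ _).le
            (abs_nonneg C)
      _ ≤ _ := by
          refine mul_le_mul_of_nonneg_right ?_ hw.le
          have : 0 ≤ C₀ * 2 ^ l := by positivity
          linarith
  · have hX : (0 : ℝ) < 1 + ‖ξ‖ := by positivity
    have h3 : (1 + ‖ξ‖) ^ l ≤ 2 ^ l * (ε : ℝ)⁻¹ := by
      refine le_trans ?_ (mul_le_mul_of_nonneg_left (h2 ε hε2) (by positivity))
      rw [← mul_pow]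
      refine pow_le_pow_left₀ (by positivity) ?_ l
      have := le_max_left (r ε) 1
      have := le_max_right (r ε) 1
      linarith
    have h4 : weight M₀ 0 (ε, ξ) ≤ 2 ^ l * weight (M₀ + 1) (-l) (ε, ξ) := by
      have e1 : weight M₀ 0 (ε, ξ) = weight M₀ (-l) (ε, ξ) * (1 + ‖ξ‖) ^ l := by
        rw [← Real.rpow_natCast]
        unfold weight
        rw [mul_assoc, ← Real.rpow_add hX, neg_add_cancel]
      have e2 : weight (M₀ + 1) (-l) (ε, ξ) = weight M₀ (-l) (ε, ξ) * (ε : ℝ)⁻¹ := by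
        rw [← Real.rpow_neg_one, ← weight_zero_right 1 (ε, ξ), weight_mul, add_zero]
      rw [e1, e2, mul_left_comm]
      exact mul_le_mul_of_nonneg_left h3 (weight_pos _ _ _).le
    calc ‖g ε ξ‖ ≤ C₀ * weight M₀ 0 (ε, ξ) := h0 ε hε0 ξ
      _ ≤ C₀ * (2 ^ l * weight (M₀ + 1) (-l) (ε, ξ)) := mul_le_mul_of_nonneg_left h4 hC₀
      _ ≤ C₀ * (2 ^ l * weight N (-l) (ε, ξ)) := by
          gcongr
          exact weight_mono hN2 le_rfl _
      _ = C₀ * 2 ^ l * weight N (-l) (ε, ξ) := by ring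
      _ ≤ _ := by
          refine mul_le_mul_of_nonneg_right ?_ hw.le
          linarith [abs_nonneg C]

theorem exists_bound_of_isModerate {Ω : TopologicalSpace.Opens (Eucl n)} {u : Param → Eucl n → ℂ}
    (hu : IsModerate Ω u) {K : Set (Eucl n)} (hK : IsCompact K) (hKΩ : K ⊆ Ω) :
    ∃ N : ℕ, ∃ C : ℝ, 0 ≤ C ∧ ∃ ε₀ > 0, ∀ ε : Param, (ε : ℝ) < ε₀ → ∀ x ∈ K,
      ‖u ε x‖ ≤ C * (ε : ℝ) ^ (-(N : ℝ)) := by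
  obtain ⟨N, C, ε₀, hε₀, h⟩ := hu.2 K hK hKΩ 0
  refine ⟨N, |C|, abs_nonneg C, ε₀, hε₀, fun ε hε x hx => ?_⟩
  have := h ε hε x hx
  rw [norm_iteratedFDeriv_zero, ← Real.rpow_intCast] at this
  push_cast at this
  exact this.trans (mul_le_mul_of_nonneg_right (le_abs_self C) (Real.rpow_nonneg ε.2.1.le _))

theorem exists_fourier_cutoff_le {Ω : TopologicalSpace.Opens (Eucl n)} (φ : 𝓓(Ω, ℂ))
    (u : Moderate Ω) : ∃ N : ℕ, ∃ C : ℝ, 0 ≤ C ∧ ∃ ε₀ > 0, ∀ ε : Param, (ε : ℝ) < ε₀ → ∀ ξ,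
      ‖fourier (cutoff φ (u.2.1 ε)) ξ‖ ≤ C * weight N 0 (ε, ξ) := by
  obtain ⟨N, C, hC, ε₀, hε₀, h⟩ := exists_bound_of_isModerate u.2 φ.hasCompactSupport
    φ.tsupport_subset
  obtain ⟨C', hC'⟩ := φ.hasCompactSupport.isCompact.exists_bound_of_continuousOn
    φ.continuous.continuousOn
  refine ⟨N, MeasureTheory.volume.real (tsupport φ) * (|C'| * C), by positivity, ε₀, hε₀,
    fun ε hε ξ => ?_⟩
  refine (norm_fourier_le φ.hasCompactSupport.isCompact (cutoff_eq_zero φ (u.2.1 ε))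
    (B := |C'| * (C * (ε : ℝ) ^ (-(N : ℝ)))) (fun x hx => ?_) ξ).trans_eq ?_
  · rw [cutoff_apply, norm_mul]
    exact mul_le_mul ((hC' x hx).trans (le_abs_self _)) (h ε hε x hx) (norm_nonneg _)
      (abs_nonneg _)
  · rw [weight_zero_right]; ring

theorem iterate_partialDeriv_mem_negligible {Ω : TopologicalSpace.Opens (Eucl n)} (i : Fin n)
    {u : Moderate Ω} (hu : u ∈ Negligible Ω) (k : ℕ) :
    (Moderate.partialDeriv i)^[k] u ∈ Negligible Ω := by
  induction k with
  | zero => exact hu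
  | succ k ih =>
    rw [Function.iterate_succ_apply']
    have h0 : Moderate.partialDeriv i (0 : Moderate Ω) = 0 := by
      ext ε x
      change fderiv ℝ (fun _ => (0 : ℂ)) x _ = 0
      simp
    have := Moderate.partialDeriv_rel i ((Moderate.partialDeriv i)^[k] u) 0 (by simpa using ih)
    rwa [h0, sub_zero] at this

theorem exists_bound_of_mem_negligible {Ω : TopologicalSpace.Opens (Eucl n)} {u : Moderate Ω}
    (hu : u ∈ Negligible Ω) {K : Set (Eucl n)} (hK : IsCompact K) (hKΩ : K ⊆ Ω) :
    ∃ C : ℝ, 0 ≤ C ∧ ∃ ε₀ > 0, ∀ ε : Param, (ε : ℝ) < ε₀ → ∀ x ∈ K, ‖u.1 ε x‖ ≤ C := by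
  obtain ⟨C, ε₀, hε₀, h⟩ := hu K hK hKΩ 0 0
  refine ⟨|C|, abs_nonneg C, ε₀, hε₀, fun ε hε x hx => ?_⟩
  have := h ε hε x hx
  rw [norm_iteratedFDeriv_zero] at this
  simp only [Nat.cast_zero, zpow_zero, mul_one] at this
  exact this.trans (le_abs_self C)

/-- The net `φ u` is again negligible, so its derivatives of order `l` are bounded uniformly in `ε`;
integration by parts does the rest. -/
theorem exists_fourier_cutoff_negligible_le {Ω : TopologicalSpace.Opens (Eucl n)} (φ : 𝓓(Ω, ℂ))
    {u : Moderate Ω} (hu : u ∈ Negligible Ω) (l : ℕ) :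
    ∃ C : ℝ, 0 ≤ C ∧ ∃ ε₀ > 0, ∀ ε : Param, (ε : ℝ) < ε₀ → ∀ ξ,
      ‖fourier (cutoff φ (u.2.1 ε)) ξ‖ ≤ C * weight 0 (-l) (ε, ξ) := by
  have hK := φ.hasCompactSupport.isCompact
  let φm : Moderate Ω := ⟨fun _ => φ, fun _ => φ.contDiff.contDiffOn, fun K hK _ k => by
    obtain ⟨C, hC⟩ := hK.exists_bound_of_continuousOn
      (φ.contDiff.continuous_iteratedFDeriv (m := k) (by exact_mod_cast le_top)).continuousOn
    exact ⟨0, C, 1, one_pos, fun ε _ x hx => by simpa using hC x hx⟩⟩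
  have hw : φm * u ∈ Negligible Ω := Ideal.mul_mem_left _ _ hu
  obtain ⟨C, hC, e, he, h⟩ := exists_bound_of_mem_negligible hw hK φ.tsupport_subset
  have hd := fun i => exists_bound_of_mem_negligible
    (iterate_partialDeriv_mem_negligible i hw l) hK φ.tsupport_subset
  choose D hD e' he' h' using hd
  -- The filter argument also covers `n = 0`, where there is no minimum over the indices.
  obtain ⟨e₁, he₁, hle⟩ : ∃ e₁ > 0, ∀ i, e₁ ≤ e' i := by
    have : ∀ᶠ t in nhdsWithin (0 : ℝ) (Set.Ioi 0), ∀ i, t ≤ e' i :=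
      Filter.eventually_all.2 fun i =>
        (eventually_nhdsWithin_of_eventually_nhds (eventually_le_nhds (he' i)))
    obtain ⟨t, ht, ht0⟩ := (this.and self_mem_nhdsWithin).exists
    exact ⟨t, ht0, ht⟩
  set B : ℝ := C + ∑ i, D i
  have hB0 : 0 ≤ B := add_nonneg hC (Finset.sum_nonneg fun i _ => hD i)
  refine ⟨(2 * (n + 1)) ^ l * (MeasureTheory.volume.real (tsupport φ) * B), by positivity,
    min e e₁, lt_min he he₁, fun ε hε ξ => ?_⟩
  have heq : ∀ i, ∀ x ∈ Ω, ((Smooth.d i)^[l] (cutoff φ (u.2.1 ε)) : Smooth n) x =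
      ((Moderate.partialDeriv i)^[l] (φm * u)).1 ε x := by
    intro i
    generalize l = k
    induction k with
    | zero => intro x _; rfl
    | succ k ih =>
      rw [Function.iterate_succ_apply', Function.iterate_succ_apply']
      exact Smooth.d_eqOn Ω.isOpen ih i
  have key := norm_fourier_mul_le hK (cutoff_eq_zero φ (u.2.1 ε)) (B := B) l
    (fun x hx => (h ε (hε.trans_le (min_le_left _ _)) x hx).trans
      (le_add_of_nonneg_right (Finset.sum_nonneg fun i _ => hD i)))
    (fun i x hx => by
      rw [heq i x (φ.tsupport_subset hx)]
      refine (h' i ε ((hε.trans_le (min_le_right _ _)).trans_le (hle i)) x hx).trans ?_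
      exact (Finset.single_le_sum (f := D) (fun i _ => hD i) (Finset.mem_univ i)).trans
        (le_add_of_nonneg_left hC)) ξ
  have e2 : weight 0 (-l) (ε, ξ) = ((1 + ‖ξ‖) ^ l)⁻¹ := by
    rw [weight, neg_zero, Real.rpow_zero, one_mul, Real.rpow_neg (by positivity),
      Real.rpow_natCast]
  rw [e2, ← div_eq_mul_inv, le_div_iff₀ (by positivity)]
  exact key

theorem fourier_cutoff_sub {Ω : TopologicalSpace.Opens (Eucl n)} (φ : 𝓓(Ω, ℂ))
    (u v : Moderate Ω) (ε : Param) (ξ : Eucl n) :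
    fourier (cutoff φ ((u - v).2.1 ε)) ξ =
      fourier (cutoff φ (u.2.1 ε)) ξ - fourier (cutoff φ (v.2.1 ε)) ξ := by
  have hK := φ.hasCompactSupport.isCompact
  have hint : ∀ w : Moderate Ω, MeasureTheory.Integrable
      fun x => cutoff φ (w.2.1 ε) x * expo ξ x := fun w => by
    simp_rw [mul_comm]
    exact integrable_mul_of_eq_zero hK _ _ (cutoff_eq_zero φ (w.2.1 ε))
  unfold fourier
  rw [← MeasureTheory.integral_sub (hint u) (hint v)]
  congr 1; ext x
  change φ x * (u.1 ε x - v.1 ε x) * _ = φ x * u.1 ε x * _ - φ x * v.1 ε x * _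
  ring

/-- Rapid decrease does not depend on the representative. -/
theorem exists_fourier_cutoff_le_of_rapidlyDecreasing {Ω : TopologicalSpace.Opens (Eucl n)}
    {φ : 𝓓(Ω, ℂ)} {u v : Moderate Ω} (huv : GenFun.mk u = GenFun.mk v) {Γ : Set (Eucl n)}
    (hu : RapidlyDecreasing Γ (cutoffFourier φ u)) :
    ∃ M : ℕ, ∀ l : ℕ, ∃ C : ℝ, 0 ≤ C ∧ ∃ ε₀ > 0, ∀ ε : Param, (ε : ℝ) < ε₀ → ∀ ξ ∈ Γ,
      ‖fourier (cutoff φ (v.2.1 ε)) ξ‖ ≤ C * weight M (-l) (ε, ξ) := by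
  obtain ⟨M, hM⟩ := hu
  refine ⟨M, fun l => ?_⟩
  obtain ⟨C, hC, e, he, -, h⟩ := hM l
  have hmem : u - v ∈ Negligible Ω := Ideal.Quotient.eq.1 huv
  obtain ⟨C', hC', e', he', h'⟩ := exists_fourier_cutoff_negligible_le φ hmem l
  refine ⟨C + C', by positivity, min e e', lt_min he he', fun ε hε ξ hξ => ?_⟩
  have h1 := h ξ hξ ε (hε.trans_le (min_le_left _ _))
  rw [mul_assoc, zpow_mul_zpow_eq_weight, cutoffFourier_eq] at h1
  have h2 := h' ε (hε.trans_le (min_le_right _ _)) ξ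
  rw [fourier_cutoff_sub] at h2
  have h3 := norm_sub_le (fourier (cutoff φ (u.2.1 ε)) ξ)
    (fourier (cutoff φ (u.2.1 ε)) ξ - fourier (cutoff φ (v.2.1 ε)) ξ)
  rw [sub_sub_cancel] at h3
  have h4 : C' * weight 0 (-l) (ε, ξ) ≤ C' * weight M (-l) (ε, ξ) :=
    mul_le_mul_of_nonneg_left (weight_mono (Nat.cast_nonneg M) le_rfl _) hC'
  linarith

/-! ### The action of the operator on representatives -/

/-- The operator `Dᵢ = -i ∂ᵢ` on moderate nets. -/
def Moderate.D {Ω : TopologicalSpace.Opens (Eucl n)} (i : Fin n) (u : Moderate Ω) : Moderate Ω :=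
  (-Complex.I) • Moderate.partialDeriv i u

/-- The net `(P_ε u_ε)_ε`. -/
def DiffOp.applyNet {Ω : TopologicalSpace.Opens (Eucl n)} {m : ℕ} (P : DiffOp Ω m)
    (u : Moderate Ω) : Moderate Ω :=
  ∑ α ∈ multiIndices n m, P.coeff α * multiPow Moderate.D α u

theorem DiffOp.apply_mk {Ω : TopologicalSpace.Opens (Eucl n)} {m : ℕ} (P : DiffOp Ω m)
    (u : Moderate Ω) : P.apply (GenFun.mk u) = GenFun.mk (P.applyNet u) := by
  unfold DiffOp.apply DiffOp.applyNet
  induction multiIndices n m using Finset.cons_induction with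
  | empty => rfl
  | cons α s hα ih =>
    have h : multiPow GenFun.D α (GenFun.mk u) = GenFun.mk (multiPow Moderate.D α u) :=
      multiPow_rel (fun (U : GenFun Ω) (u : Moderate Ω) => U = GenFun.mk u)
        (fun i U u h => by rw [h]; rfl) α rfl
    rw [Finset.sum_cons, Finset.sum_cons, ih, h]
    rfl

theorem DiffOp.applyNet_eqOn {Ω : TopologicalSpace.Opens (Eucl n)} {m : ℕ} (P : DiffOp Ω m)
    {V : Set (Eucl n)} (hV : IsOpen V) (u : Moderate Ω) (ε : Param)
    {a : (Fin n → ℕ) → Smooth n} (ha : ∀ α, Set.EqOn (a α) ((P.coeff α).1 ε) V)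
    {v : Smooth n} (hv : Set.EqOn v (u.1 ε) V) :
    Set.EqOn (∑ α ∈ multiIndices n m, a α * multiPow (fun i => Smooth.D i) α v : Smooth n)
      ((P.applyNet u).1 ε) V := by
  intro x hx
  have h1 : (P.applyNet u).1 ε x = ∑ α ∈ multiIndices n m,
      (P.coeff α).1 ε x * (multiPow Moderate.D α u).1 ε x := by
    unfold DiffOp.applyNet
    induction multiIndices n m using Finset.cons_induction with
    | empty => rfl
    | cons α s hα ih =>
      rw [Finset.sum_cons, Finset.sum_cons, ← ih]
      rfl
  rw [h1, Smooth.sum_apply]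
  refine Finset.sum_congr rfl fun α _ => ?_
  have h2 : Set.EqOn (multiPow (fun i => Smooth.D i) α v : Smooth n)
      ((multiPow Moderate.D α u).1 ε) V :=
    multiPow_rel (fun (f : Smooth n) (w : Moderate Ω) => Set.EqOn f (w.1 ε) V)
      (fun i f w h y hy => congrArg (-Complex.I * ·) (Smooth.d_eqOn hV h i hy)) α hv
  rw [Smooth.mul_apply, ha α hx, h2 hx]

/-! ### Conic neighbourhoods -/

/-- The cone over the ball of radius `r` around `ξ₀`. -/
def cone (ξ₀ : Eucl n) (r : ℝ) : Set (Eucl n) := {ξ | ∃ t : ℝ, 0 < t ∧ t • ξ ∈ Metric.ball ξ₀ r}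

theorem isOpen_cone (ξ₀ : Eucl n) (r : ℝ) : IsOpen (cone ξ₀ r) := by
  have : cone ξ₀ r = ⋃ t ∈ Set.Ioi (0 : ℝ), (fun ξ => t • ξ) ⁻¹' Metric.ball ξ₀ r := by
    ext ξ; simp [cone]
  rw [this]
  exact isOpen_biUnion fun t _ => Metric.isOpen_ball.preimage (continuous_const_smul t)

theorem isConic_cone (ξ₀ : Eucl n) (r : ℝ) : IsConic (cone ξ₀ r) := by
  rintro ξ ⟨t, ht, h⟩ s hs
  exact ⟨t * s⁻¹, by positivity, by rwa [smul_smul, inv_mul_cancel_right₀ hs.ne']⟩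

theorem mem_cone (ξ₀ : Eucl n) {r : ℝ} (hr : 0 < r) : ξ₀ ∈ cone ξ₀ r :=
  ⟨1, one_pos, by simpa using hr⟩

/-- Rescale so that `tξ` lies in the ball of radius `r`. Then `t|ξ| ≤ |ξ₀| + r`, hence `t|η| ≤ r`,
and `t(ξ + η)` stays in the ball of radius `2r`. -/
theorem add_mem_of_mem_cone {Γ : Set (Eucl n)} (hΓ : IsConic Γ) {ξ₀ : Eucl n} {r : ℝ} (hr : 0 < r)
    (h : Metric.ball ξ₀ (2 * r) ⊆ Γ) {ξ : Eucl n} (hξ : ξ ∈ cone ξ₀ r) {η : Eucl n}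
    (hη : ‖η‖ ≤ min (1 / 2) (r / (‖ξ₀‖ + r)) * ‖ξ‖) : ξ + η ∈ Γ := by
  obtain ⟨t, ht, hξ⟩ := hξ
  rw [mem_ball_iff_norm] at hξ
  have h0 : 0 < ‖ξ₀‖ + r := by positivity
  have h1 : t * ‖ξ‖ ≤ ‖ξ₀‖ + r := by
    have := norm_sub_norm_le (t • ξ) ξ₀
    rw [norm_smul, Real.norm_eq_abs, abs_of_pos ht] at this
    linarith
  have h2 : t * ‖η‖ ≤ r := by
    have h3 : ‖η‖ ≤ r / (‖ξ₀‖ + r) * ‖ξ‖ :=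
      hη.trans (mul_le_mul_of_nonneg_right (min_le_right _ _) (norm_nonneg _))
    calc t * ‖η‖ ≤ t * (r / (‖ξ₀‖ + r) * ‖ξ‖) := mul_le_mul_of_nonneg_left h3 ht.le
      _ = r / (‖ξ₀‖ + r) * (t * ‖ξ‖) := by ring
      _ ≤ r / (‖ξ₀‖ + r) * (‖ξ₀‖ + r) := mul_le_mul_of_nonneg_left h1 (by positivity)
      _ = r := div_mul_cancel₀ _ h0.ne'
  have h4 : t • (ξ + η) ∈ Γ := h (by
    rw [mem_ball_iff_norm, smul_add, add_sub_right_comm]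
    refine (norm_add_le _ _).trans_lt ?_
    rw [norm_smul t η, Real.norm_eq_abs, abs_of_pos ht]
    linarith)
  have := hΓ _ h4 t⁻¹ (by positivity)
  rwa [smul_smul, inv_mul_cancel₀ ht.ne', one_smul] at this

/-! ### The microlocal estimate over a ball and a cone -/

theorem contDiffOn_symbol {Ω : TopologicalSpace.Opens (Eucl n)} {m : ℕ} (P : DiffOp Ω m)
    (ε : Param) (ξ : Eucl n) : ContDiffOn ℝ ∞ (fun x => P.symbol ε x ξ) Ω :=
  ContDiffOn.sum fun α _ => ((P.coeff α).2.1 ε).mul contDiffOn_const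

theorem smoothSymbol_zero_eqOn {Ω : TopologicalSpace.Opens (Eucl n)} {m : ℕ} (P : DiffOp Ω m)
    {V : Set (Eucl n)} (ε : Param) {a : (Fin n → ℕ) → Smooth n}
    (ha : ∀ α, Set.EqOn (a α) ((P.coeff α).1 ε) V) (ξ : Eucl n) :
    Set.EqOn (smoothSymbol m a 0 ξ) (fun x => P.symbol ε x ξ) V := by
  intro x hx
  simp only [smoothSymbol, DiffOp.symbol, Smooth.sum_apply, Smooth.smul_apply]
  refine Finset.sum_congr rfl fun α _ => ?_
  rw [ha α hx]
  simp [mul_comm]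

/-- The reciprocal of a smooth function on a neighbourhood of a closed ball without zeros on the
closed ball coincides on the ball of half the radius with a globally smooth function. -/
theorem exists_smooth_mul_eq_one {U : Set (Eucl n)} (hU : IsOpen U) {f : Eucl n → ℂ}
    (hf : ContDiffOn ℝ ∞ f U) {x₀ : Eucl n} {R : ℝ} (hR : 0 < R)
    (h : Metric.closedBall x₀ R ⊆ U) (h0 : ∀ x ∈ Metric.closedBall x₀ R, f x ≠ 0) :
    ∃ F : Smooth n, ∀ x ∈ Metric.ball x₀ (R / 2), f x * F x = 1 := by
  have hU' : IsOpen (U ∩ f ⁻¹' {0}ᶜ) :=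
    hf.continuousOn.isOpen_inter_preimage hU isOpen_compl_singleton
  obtain ⟨F, hF⟩ := exists_smooth_eqOn hU' (f := fun x => (f x)⁻¹)
    ((hf.mono Set.inter_subset_left).inv fun x hx => hx.2) hR fun x hx => ⟨h hx, h0 x hx⟩
  refine ⟨F, fun x hx => ?_⟩
  have hx' : x ∈ Metric.closedBall x₀ R :=
    Metric.closedBall_subset_closedBall (by linarith) (Metric.ball_subset_closedBall hx)
  rw [hF hx, mul_inv_cancel₀ (h0 x hx')]

/-- Microlocal regularity of `u` at `(x₀, ξ₀)`, from the microlocal regularity of `P u` there and the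
hypoellipticity estimates over a ball around `x₀` and a cone around `ξ₀`. -/
theorem exists_rapidlyDecreasing {Ω : TopologicalSpace.Opens (Eucl n)} {m : ℕ} (P : DiffOp Ω m)
    (v : Moderate Ω) {φ : 𝓓(Ω, ℂ)} {x₀ : Eucl n} {R : ℝ} (hR : 0 < R)
    (hRΩ : Metric.closedBall x₀ R ⊆ Ω) (hφ : ∀ x ∈ Metric.closedBall x₀ R, φ x ≠ 0)
    {Γ Γ' : Set (Eucl n)} {c : ℝ} (hc : 0 < c) (hc2 : c ≤ 1 / 2)
    (hΓ : ∀ ξ ∈ Γ, ∀ η : Eucl n, ‖η‖ ≤ c * ‖ξ‖ → ξ + η ∈ Γ') {M : ℕ}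
    (hM : ∀ l : ℕ, ∃ C : ℝ, 0 ≤ C ∧ ∃ ε₀ > 0, ∀ ε : Param, (ε : ℝ) < ε₀ → ∀ ξ ∈ Γ',
      ‖fourier (cutoff φ ((P.applyNet v).2.1 ε)) ξ‖ ≤ C * weight M (-l) (ε, ξ))
    {Λ : Set (Eucl n × Eucl n)}
    (hΛ : ∀ x ∈ Metric.closedBall x₀ R, ∀ ξ ∈ Γ, (x, ξ) ∈ Λ) {m₀ δ ρ : ℝ} (hδ : 0 ≤ δ)
    (hδρ : δ < ρ) (hρ : ρ ≤ 1) (hlow : LowerBound P Λ m₀ (Metric.closedBall x₀ R))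
    (hsym : SymbolBounds P Λ δ ρ (Metric.closedBall x₀ R)) :
    ∃ ψ : 𝓓(Ω, ℂ), ψ x₀ ≠ 0 ∧ RapidlyDecreasing Γ (cutoffFourier ψ v) := by
  -- Three nested balls: the hypotheses hold on `K`, the globally smooth replacements agree with the
  -- given functions on `V`, and all test functions are supported in `F`.
  set K := Metric.closedBall x₀ R with hKdef
  set V := Metric.ball x₀ (R / 2) with hVdef
  set F := Metric.closedBall x₀ (R / 4) with hFdef
  have hV : IsOpen V := Metric.isOpen_ball
  have hK : IsCompact K := isCompact_closedBall _ _
  have hF : IsCompact F := isCompact_closedBall _ _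
  have hVK : V ⊆ K := Metric.ball_subset_closedBall.trans
    (Metric.closedBall_subset_closedBall (by linarith))
  have hFV : F ⊆ V := Metric.closedBall_subset_ball (by linarith)
  choose a ha using fun (ε : Param) (α : Fin n → ℕ) =>
    exists_smooth_eqOn Ω.isOpen ((P.coeff α).2.1 ε) hR hRΩ
  choose v' hv' using fun ε : Param => exists_smooth_eqOn Ω.isOpen (v.2.1 ε) hR hRΩ
  -- The function `κ` equals `1/φ` on `V`. It allows the cut-off `φ` to be inserted in the integral
  -- of `P u`.
  obtain ⟨κ, hκ⟩ := exists_smooth_mul_eq_one isOpen_univ (f := φ) φ.contDiff.contDiffOn hR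
    (Set.subset_univ _) hφ
  -- Where the symbol has zeros on `K`, the junk value `0` is taken; `hlow'` excludes this
  -- eventually along `tailFilter Γ`.
  have hp'ex : ∀ z : Param × Eucl n, ∃ p' : Smooth n, (∀ x ∈ K, P.symbol z.1 x z.2 ≠ 0) →
      ∀ x ∈ V, P.symbol z.1 x z.2 * p' x = 1 := fun z => by
    by_cases h : ∀ x ∈ K, P.symbol z.1 x z.2 ≠ 0
    · obtain ⟨p', hp'⟩ := exists_smooth_mul_eq_one Ω.isOpen (contDiffOn_symbol P z.1 z.2) hR hRΩ h
      exact ⟨p', fun _ => hp'⟩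
    · exact ⟨0, fun h' => absurd h' h⟩
  choose p' hp' using hp'ex
  obtain ⟨q, -, r, hr, e₁, he₁, hlow⟩ := hlow
  have hlow' : ∀ᶠ z in tailFilter Γ, ∀ x ∈ K,
      (weight q (-m₀) z)⁻¹ ≤ ‖P.symbol z.1 x z.2‖ := by
    refine eventually_tailFilter.2 ⟨r, hr, e₁, he₁, fun ε ξ hε hξ hrξ x hx => ?_⟩
    refine le_trans (le_of_eq ?_) (hlow x ξ hx (hΛ x hx ξ hξ) ε hε hrξ)
    rw [weight, mul_inv, ← Real.rpow_neg ε.2.1.le, ← Real.rpow_neg (by positivity), neg_neg,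
      neg_neg]
  have hsmul : ∀ᶠ z in tailFilter Γ, ∀ x ∈ V, P.symbol z.1 x z.2 * p' z x = 1 := by
    filter_upwards [hlow'] with z hz
    refine hp' z fun x hx h0 => ?_
    have := hz x hx
    rw [h0, norm_zero] at this
    exact absurd this (not_le.2 (inv_pos.2 (weight_pos _ _ _)))
  have hs0 : ∀ z : Param × Eucl n, ∀ x ∈ V,
      smoothSymbol m (a z.1) 0 z.2 x = P.symbol z.1 x z.2 := fun z =>
    smoothSymbol_zero_eqOn P z.1 (ha z.1) z.2
  have hp : ∀ᶠ z in tailFilter Γ, ∀ x ∈ V, smoothSymbol m (a z.1) 0 z.2 x * p' z x = 1 := by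
    filter_upwards [hsmul] with z hz x hx
    rw [hs0 z x hx, hz x hx]
  have hb : ∀ α β : Fin n → ℕ, len β ≤ m → ∀ η > 0, ∀ᶠ z in tailFilter Γ, ∀ x ∈ V,
      ‖(multiPow (fun i => Smooth.d i) α (smoothSymbol m (a z.1) β z.2) : Smooth n) x‖ ≤
        weight η (δ * len α - ρ * len β) z * ‖smoothSymbol m (a z.1) 0 z.2 x‖ := by
    intro α β hβ η hη
    obtain ⟨s, r', hs, hr', e, he, h⟩ := hsym α
    have h1 : ∀ᶠ z in tailFilter Γ, ∀ x ∈ K, ‖P.symbolDeriv α β z.1 x z.2‖ ≤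
        s z.1 * ‖P.symbol z.1 x z.2‖ * (1 + ‖z.2‖) ^ (δ * (len α : ℝ) - ρ * (len β : ℝ)) :=
      eventually_tailFilter.2 ⟨r', hr', e, he, fun ε ξ hε hξ hrξ x hx =>
        h β hβ x ξ hx (hΛ x hx ξ hξ) ε hε hrξ⟩
    filter_upwards [h1, hs.eventually_le Γ hη] with z hz hz' x hx
    rw [symbolDeriv_eqOn P hV z.1 (ha z.1) α β z.2 hx, hs0 z x hx]
    refine (hz x (hVK hx)).trans ?_
    rw [weight, mul_right_comm]
    gcongr
  have hq : ∀ᶠ z in tailFilter Γ, ∀ x ∈ V, ‖p' z x‖ ≤ weight q (-m₀) z := by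
    filter_upwards [hlow', hsmul] with z h1 h2 x hx
    have h3 := congrArg norm (h2 x hx)
    rw [norm_mul, norm_one] at h3
    rw [eq_inv_of_mul_eq_one_right h3]
    exact inv_le_of_inv_le₀ (weight_pos _ _ _) (h1 x (hVK hx))
  let χ : ContDiffBump x₀ := ⟨R / 8, R / 4, by positivity, by linarith⟩
  have hχ : ContDiff ℝ ∞ fun x => (χ x : ℂ) := Complex.ofRealCLM.contDiff.comp χ.contDiff
  have hχF : ∀ x ∉ F, (χ x : ℂ) = 0 := fun x hx => by
    rw [χ.zero_of_le_dist (by simpa [hFdef] using (not_le.1 hx).le), Complex.ofReal_zero]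
  let ψ' : Smooth n := ⟨fun x => (χ x : ℂ), hχ⟩
  have hψ' : ∀ x ∉ F, ψ' x = 0 := hχF
  let ψ : 𝓓(Ω, ℂ) := ⟨fun x => (χ x : ℂ), hχ, HasCompactSupport.intro hF hχF,
    (closure_minimal (fun x (hx : (χ x : ℂ) ≠ 0) => by_contra fun h => hx (hχF x h)) hF.isClosed).trans
      (hFV.trans (hVK.trans hRΩ))⟩
  refine ⟨ψ, ?_, ?_⟩
  · change (χ x₀ : ℂ) ≠ 0
    rw [χ.one_of_mem_closedBall (Metric.mem_closedBall_self (by positivity))]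
    simp
  obtain ⟨N₀, C₀, hC₀, e₀, he₀, h0⟩ := exists_fourier_cutoff_le ψ v
  obtain ⟨N₁, C₁, hC₁, e₂, he₂, h1⟩ := exists_fourier_cutoff_le φ (P.applyNet v)
  obtain ⟨N₂, C₂, hC₂, e₃, he₃, h2⟩ := exists_bound_of_isModerate v.2 hF
    (hFV.trans (hVK.trans hRΩ))
  -- All exponents of `1/ε` are fixed here, before the order of decrease `l` is introduced. The
  -- added units are the room required by the strict inequality `q' > q` in `SymbolClass`.
  set M₁ : ℝ := max (M : ℝ) N₁ with hM₁
  refine rapidlyDecreasing_of_tailFilter (M := max (M₁ + (q + 1)) (N₂ + 1)) hC₀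
    ⟨e₀, he₀, h0⟩ fun l => ?_
  -- Enough Neumann terms that `R^N ψ` has order at most `-l`.
  obtain ⟨N, hN⟩ := exists_nat_ge (l / (ρ - δ))
  rw [div_le_iff₀ (by linarith)] at hN
  let w : Param × Eucl n → Smooth n := fun z => neumannSum m (a z.1) z.2 (p' z) ψ' N
  have hw0 : ∀ z, ∀ x ∉ F, w z x = 0 := fun z =>
    neumannSum_eq_zero hF.isClosed m (a z.1) z.2 (p' z) hψ' N
  have hg0 : ∀ z, ∀ x ∉ F, (κ * (p' z * w z)) x = 0 := fun z x hx => by simp [hw0 z x hx]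
  have hgs : ∀ k, SymbolClass Γ V δ k q (-m₀) fun z => κ * (p' z * w z) := fun k =>
    ((SymbolClass.const hδ hK hVK κ).mul ((symbolClass_inv hV hp hb hq k).mul
      (symbolClass_neumannSum hV hδ hδρ hp hb hK hVK ψ' N k))).mono (by simp) (by simp)
  obtain ⟨C, hC0, hC⟩ := integral_mul_expo_mul_le (q := q) (μ := -m₀) (M := M₁)
    φ.hasCompactSupport.isCompact hF hFV hc hc2 hΓ
    (f := fun ε => cutoff φ ((P.applyNet v).2.1 ε))
    (fun ε => cutoff_eq_zero φ ((P.applyNet v).2.1 ε)) hC₁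
    ⟨e₂, he₂, fun ε hε ξ => (h1 ε hε ξ).trans
      (mul_le_mul_of_nonneg_left (weight_mono (le_max_right _ _) le_rfl _) hC₁)⟩
    (fun l => by
      obtain ⟨C, hC, e, he, h⟩ := hM l
      exact ⟨C, hC, e, he, fun ε hε ξ hξ => (h ε hε ξ hξ).trans
        (mul_le_mul_of_nonneg_left (weight_mono (le_max_left _ _) le_rfl _) hC)⟩)
    hδ (hδρ.trans_le hρ) hg0 hgs l
  have hrem := (symbolClass_iterate_remainder hV hδ hδρ hp hb hK hVK ψ' N 0).bound 1
    (by norm_num)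
  refine ⟨C + MeasureTheory.volume.real F * C₂, ?_⟩
  filter_upwards [hC, hrem, hp, eventually_lt_tailFilter Γ he₃] with z hCz hremz hpz hez
  set Rψ : Smooth n := (remainder m (a z.1) z.2 (p' z))^[N] ψ' with hRψ
  have hRψ0 : ∀ x ∉ F, Rψ x = 0 := iterate_remainder_eq_zero hF.isClosed m (a z.1) z.2 (p' z) hψ' N
  have hh0 : ∀ x ∉ F, (p' z * w z) x = 0 := fun x hx => by simp [hw0 z x hx]
  have hint : ∀ g : Smooth n, (∀ x ∉ F, g x = 0) →
      MeasureTheory.Integrable fun x => v' z.1 x * (expo z.2 x * g x) := fun g hg =>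
    integrable_mul_of_eq_zero hF (v' z.1) (expo z.2 * g) fun x hx => by simp [hg x hx]
  have htr := transposed_neumannSum hF.isClosed m (a z.1) z.2 (p' := p' z)
    (fun x hx => hpz x (hFV hx)) hψ' N
  have hL0 : ∀ x ∉ F, transposed m (a z.1) z.2 (p' z * w z) x = 0 := fun x hx => by
    rw [htr, Smooth.sub_apply, hψ' x hx, hRψ0 x hx, sub_zero]
  have e1 : cutoffFourier ψ v z.1 z.2 = ∫ x, v' z.1 x * (expo z.2 x * ψ' x) := by
    unfold cutoffFourier
    congr 1; ext x
    change ψ' x * v.1 z.1 x * expo z.2 x = _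
    by_cases hx : x ∈ F
    · rw [hv' z.1 (hFV hx)]; ring
    · rw [hψ' x hx]; ring
  have e2 : ∫ x, v' z.1 x * (expo z.2 x * ψ' x) =
      (∫ x, v' z.1 x * (expo z.2 x * transposed m (a z.1) z.2 (p' z * w z) x)) +
        ∫ x, v' z.1 x * (expo z.2 x * Rψ x) := by
    rw [← MeasureTheory.integral_add (hint _ hL0) (hint _ hRψ0)]
    congr 1; ext x
    rw [htr, Smooth.sub_apply]
    ring
  -- The operator is moved back onto `v'`. On `F` the result is the net of `P u`, and `φ κ = 1`
  -- there.
  have e3 : ∫ x, v' z.1 x * (expo z.2 x * transposed m (a z.1) z.2 (p' z * w z) x) =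
      ∫ x, cutoff φ ((P.applyNet v).2.1 z.1) x * (expo z.2 x * (κ * (p' z * w z)) x) := by
    rw [← integral_apply_mul_expo hF m (a z.1) (v' z.1) (p' z * w z) hh0 z.2]
    congr 1; ext x
    by_cases hx : x ∈ F
    · rw [P.applyNet_eqOn hV v z.1 (ha z.1) (hv' z.1) (hFV hx), cutoff_apply,
        Smooth.mul_apply κ]
      linear_combination (-(P.applyNet v).1 z.1 x * expo z.2 x * (p' z * w z) x) *
        hκ x (hFV hx)
    · rw [hh0 x hx, hg0 z x hx]; simp
  have b2 : ‖∫ x, v' z.1 x * (expo z.2 x * Rψ x)‖ ≤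
      MeasureTheory.volume.real F * C₂ * weight (N₂ + 1) (-l) z := by
    have e4 : ∫ x, v' z.1 x * (expo z.2 x * Rψ x) = fourier (v' z.1 * Rψ) z.2 := by
      unfold fourier
      congr 1; ext x
      rw [Smooth.mul_apply]; ring
    rw [e4]
    refine (norm_fourier_le hF (B := C₂ * weight (N₂ + 1) (-l) z)
      (fun x hx => by simp [hRψ0 x hx]) (fun x hx => ?_) z.2).trans_eq (by ring)
    rw [Smooth.mul_apply, norm_mul, hv' z.1 (hFV hx)]
    refine (mul_le_mul (h2 z.1 hez x hx) (hremz x (hFV hx)) (norm_nonneg _)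
      (mul_nonneg hC₂ (Real.rpow_nonneg z.1.2.1.le _))).trans ?_
    rw [mul_assoc, ← weight_zero_right N₂ z, weight_mul]
    exact mul_le_mul_of_nonneg_left (weight_mono le_rfl (by linarith) z) hC₂
  rw [e1, e2, e3, add_mul]
  refine (norm_add_le _ _).trans (add_le_add (hCz.trans ?_) (b2.trans ?_))
  · exact mul_le_mul_of_nonneg_left (weight_mono (le_max_left _ _) le_rfl z) hC0
  · exact mul_le_mul_of_nonneg_left (weight_mono (le_max_right _ _) le_rfl z) (by positivity)

end Colombeau

end

/-! ### Localisation and conclusion -/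

theorem mainTheorem3 {n : ℕ} (Ω : TopologicalSpace.Opens (Colombeau.Eucl n)) {m : ℕ}
    (P : Colombeau.DiffOp Ω m) (u : Colombeau.GenFun Ω) :
    Colombeau.waveFrontSet u ⊆
      Colombeau.waveFrontSet (P.apply u) ∪
        (Colombeau.cotangent Ω \ Colombeau.microHypoellipticSet P) := by
  rintro ⟨x₀, ξ₀⟩ ⟨hz, hreg⟩
  by_contra hcon
  rw [Set.mem_union, not_or] at hcon
  obtain ⟨hPu, hhyp⟩ := hcon
  have hPu' : Colombeau.MicroRegularAt (P.apply u) x₀ ξ₀ := by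
    by_contra h
    exact hPu ⟨hz, h⟩
  have hhyp' : (x₀, ξ₀) ∈ Colombeau.microHypoellipticSet P := by
    by_contra h
    exact hhyp ⟨hz, h⟩
  obtain ⟨Λ, ⟨⟨hΛo, hΛc, hΛcon⟩, m₀, δ, ρ, hδ, hδρ, hρ, hest⟩, hmem⟩ := hhyp'
  obtain ⟨w, hw, φ, hφ, Γ', hΓo, hΓc, hξΓ, hrd⟩ := hPu'
  obtain ⟨v, rfl⟩ : ∃ v, Colombeau.GenFun.mk v = u := Ideal.Quotient.mk_surjective u
  rw [P.apply_mk] at hw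
  -- The representative witnessing regularity of `P u` need not be `P.applyNet v`, so the estimate
  -- is transferred to the latter.
  obtain ⟨M, hM⟩ := Colombeau.exists_fourier_cutoff_le_of_rapidlyDecreasing hw hrd
  obtain ⟨s₁, hs₁, h1⟩ := Metric.isOpen_iff.1 hΛo _ hmem
  obtain ⟨s₂, hs₂, h2⟩ := Metric.isOpen_iff.1 hΓo _ hξΓ
  obtain ⟨s₃, hs₃, h3⟩ := Metric.isOpen_iff.1 Ω.isOpen _ hz.1
  obtain ⟨s₄, hs₄, h4⟩ := Metric.isOpen_iff.1
    (isOpen_compl_singleton.preimage φ.continuous : IsOpen (φ ⁻¹' {0}ᶜ)) x₀ hφ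
  rw [← ball_prod_same] at h1
  set R := min s₁ (min s₃ s₄) / 2 with hR
  have hmin : 0 < min s₁ (min s₃ s₄) := lt_min hs₁ (lt_min hs₃ hs₄)
  have hR0 : 0 < R := by positivity
  have hR1 : Metric.closedBall x₀ R ⊆ Metric.ball x₀ (min s₁ (min s₃ s₄)) :=
    Metric.closedBall_subset_ball (by linarith)
  -- Half the radius, because the ball of radius `2r` around `ξ₀` has to lie in `Γ'` for frequencies
  -- to be shifted within it.
  set r := min s₁ s₂ / 2 with hr
  have hr0 : 0 < r := by have := lt_min hs₁ hs₂; positivity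
  have hΛ : ∀ x ∈ Metric.closedBall x₀ R, ∀ ξ ∈ Colombeau.cone ξ₀ r, (x, ξ) ∈ Λ := by
    rintro x hx ξ ⟨t, ht, hξ⟩
    have h5 : (x, t • ξ) ∈ Λ := h1 ⟨Metric.ball_subset_ball (min_le_left _ _) (hR1 hx),
      Metric.ball_subset_ball (by have := min_le_left s₁ s₂; linarith) hξ⟩
    have := hΛcon x _ h5 t⁻¹ (by positivity)
    rwa [smul_smul, inv_mul_cancel₀ ht.ne', one_smul] at this
  have hξ₀ := Colombeau.mem_cone ξ₀ hr0
  have hKΛ : Metric.closedBall x₀ R ⊆ Prod.fst '' Λ := fun x hx => ⟨(x, ξ₀), hΛ x hx ξ₀ hξ₀, rfl⟩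
  obtain ⟨hlow, hsym⟩ := hest _ (isCompact_closedBall x₀ R) hKΛ
  obtain ⟨ψ, hψ, hψv⟩ := Colombeau.exists_rapidlyDecreasing P v hR0
    (hR1.trans ((Metric.ball_subset_ball ((min_le_right _ _).trans (min_le_left _ _))).trans h3))
    (fun x hx => h4 (Metric.ball_subset_ball ((min_le_right _ _).trans (min_le_right _ _))
      (hR1 hx)))
    (c := min (1 / 2) (r / (‖ξ₀‖ + r))) (by positivity) (min_le_left _ _)
    (fun ξ hξ η hη => Colombeau.add_mem_of_mem_cone hΓc hr0
      ((Metric.ball_subset_ball (by have := min_le_right s₁ s₂; linarith)).trans h2) hξ hη)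
    hM hΛ hδ hδρ hρ hlow hsym
  exact hreg ⟨v, rfl, ψ, hψ, _, Colombeau.isOpen_cone ξ₀ r, Colombeau.isConic_cone ξ₀ r, hξ₀, hψv⟩
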